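/- All graphs are finite and simple, and functions $f$ on the vertex set $V(G)$ of a graph $G$ take values in $\{0,1,2\}$. Write $N(v)$ for the open neighbourhood of $v$ and $f(S)=\sum_{v\in S}f(v)$; the weight of $f$ is $f(V(G))$. **Domination parameters.** A *total Roman $\{2\}$-dominating function* (TR2DF) on $G$ is a function $f$ such that every vertex has a neighbour $u$ with $f(u)>0$, and $f(N(v))\ge 2$ for every $v$ with $f(v)=0$. A *total Roman dominating function* (TRDF) on $G$ is a function $f$ such that every vertex has a neighbour $u$ with $f(u)>0$, and every $v$ with $f(v)=0$ has a neighbour $u$ with $f(u)=2$. The minimum weights of a TR2DF and of a TRDF on $G$ are denoted $\gamma_{t\{R2\}}(G)$ and $\gamma_{tR}(G)$; functions attaining them are called $\gamma_{t\{R2\}}(G)$-functions and $\gamma_{tR}(G)$-functions. A *near-TR2DF relative to a vertex $v$* is a function $f$ such that the subgraph induced by $\{u: f(u)>0\}$ has no isolated vertex, $f(N(u))\ge 2$ for every $u\neq v$ with $f(u)=0$, and, if $f(v)=0$, $f(N(v))\ge 1$. The vertex $v$ is *near stable* in $G$ if the minimum weight of a near-TR2DF relative to $v$ on $G$ equals $\gamma_{t\{R2\}}(G)$.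 **Types of vertices.** A *leaf* is a vertex of degree one; a *support* vertex is a vertex adjacent to a leaf; a *semi-support* vertex is a vertex that is not a leaf and is adjacent to a support vertex. $L(G)$ and $SS(G)$ denote the sets of leaves and of semi-support vertices of $G$, and - $S_{adj}(G)$ is the set of support vertices that are adjacent to another support vertex; - $S_{tR,2}(G)$ is the set of support vertices $v$ with $f(v)=2$ for some $\gamma_{tR}(G)$-function $f$; - $L_{tR,1}(G)$ is the set of leaves $v$ with $f(v)=1$ for some $\gamma_{tR}(G)$-function $f$; - $W_0(G)$ is the set of vertices $v$ with $f(v)=0$ for every $\gamma_{t\{R2\}}(G)$-function $f$; - $S_1(G)$ is the set of support vertices $v$ with $f(v)=1$ for every $\gamma_{t\{R2\}}(G)$-function $f$. **The family $\mathcal F$.** Let $P_n$ be the path of order $n$. For $r\ge 1$, $R_r$ is the tree obtained from $r$ disjoint copies of $P_4$ and one further vertex, its *centre*, by joining the centre to one support vertex of each copy of $P_4$. The family $\mathcal F$ consists of all graphs isomorphic to the last term of a finite sequence $T_0,\dots,T_k$ ($k\ge 0$) with $T_0\cong P_2$, where each $T_i$, $i\ge 1$, is obtained from $T'=T_{i-1}$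 by one of the following operations (to join two vertices means to add an edge between them): - $F_1$: add a tree $R_r$ for some $r\ge 1$, and join its centre to an arbitrary vertex of $T'$; - $F_2$: add a new vertex and join it to a vertex of $S_{tR,2}(T')$; - $F_3$: add a new vertex and join it to a vertex of $S_1(T')$; - $F_4$: add a path $P_2$ and join one of its leaves to a vertex of $S_{adj}(T')$; - $F_5$: add a path $P_3$ and identify its support vertex with a vertex of $L_{tR,1}(T')$; - $F_6$: add a path $P_2$ and join one of its leaves to a vertex of $L(T')\cup SS(T')$ that is near stable in $T'$; - $F_7$: add a path $P_3$ and join one of its leaves to a vertex of $W_0(T')$. **Theorem.** Let $T$ be a tree of order $n\ge 2$. Then $\gamma_{t\{R2\}}(T)=\gamma_{tR}(T)$ if and only if $T\in\mathcal F$. -/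

import Mathlib

universe u

namespace TotalRoman

/-! ### Leaves, support vertices, semi-support vertices -/

section Vertices

variable {V : Type u}

/-- A leaf: a vertex of degree one. -/
def IsLeaf (G : SimpleGraph V) (v : V) : Prop := (G.neighborSet v).ncard = 1

/-- A support vertex: a vertex adjacent to a leaf. -/
def IsSupport (G : SimpleGraph V) (v : V) : Prop := ∃ h, G.Adj v h ∧ IsLeaf G h

/-- A semi-support vertex: a vertex that is not a leaf and is adjacent to a support vertex. -/
def IsSemiSupport (G : SimpleGraph V) (v : V) : Prop :=
  ¬ IsLeaf G v ∧ ∃ s, G.Adj v s ∧ IsSupport G s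

/-- The set `S_adj(G)` of the support vertices that are not isolated in the subgraph induced by the
support vertices. -/
def supportAdj (G : SimpleGraph V) : Set V :=
  {v | IsSupport G v ∧ ∃ s, G.Adj v s ∧ IsSupport G s}

end Vertices

/-! ### Dominating functions with values in `{0, 1, 2}` -/

section Domination

variable {V : Type u} [Fintype V]

/-- The weight `ω(f)`. -/
def weight (f : V → Fin 3) : ℕ := ∑ v, (f v : ℕ)

open scoped Classical in
/-- The weight `f(N(v))` of the open neighbourhood of `v`. -/
noncomputable def nbrWeight (G : SimpleGraph V) (f : V → Fin 3) (v : V) : ℕ :=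
  ∑ x with G.Adj v x, (f x : ℕ)

/-- Dominating function. -/
def IsDF (G : SimpleGraph V) (f : V → Fin 3) : Prop :=
  ∀ v, f v = 0 → ∃ x, G.Adj v x ∧ 0 < f x

/-- Total dominating function (TDF). -/
def IsTDF (G : SimpleGraph V) (f : V → Fin 3) : Prop :=
  ∀ v, ∃ x, G.Adj v x ∧ 0 < f x

/-- Roman {2}-dominating function (R2DF). -/
def IsR2DF (G : SimpleGraph V) (f : V → Fin 3) : Prop :=
  IsDF G f ∧ ∀ v, f v = 0 → 2 ≤ nbrWeight G f v

/-- Total Roman {2}-dominating function (TR2DF). -/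
def IsTR2DF (G : SimpleGraph V) (f : V → Fin 3) : Prop :=
  IsR2DF G f ∧ IsTDF G f

/-- Total Roman dominating function (TRDF). -/
def IsTRDF (G : SimpleGraph V) (f : V → Fin 3) : Prop :=
  IsTDF G f ∧ ∀ v, f v = 0 → ∃ x, G.Adj v x ∧ f x = 2

/-- Near-TR2DF relative to `v`. The last clause says that the subgraph induced by the vertices of
positive label has no isolated vertex. -/
def IsNearTR2DF (G : SimpleGraph V) (v : V) (f : V → Fin 3) : Prop :=
  (∀ x, f x = 0 →
      (x = v → 1 ≤ nbrWeight G f x) ∧ (x ≠ v → 2 ≤ nbrWeight G f x)) ∧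
    ∀ x, 0 < f x → ∃ y, G.Adj x y ∧ 0 < f y

/-- The total Roman {2}-domination number. -/
noncomputable def gammaTR2 (G : SimpleGraph V) : ℕ :=
  sInf {w | ∃ f : V → Fin 3, IsTR2DF G f ∧ weight f = w}

/-- The total Roman domination number. -/
noncomputable def gammaTR (G : SimpleGraph V) : ℕ :=
  sInf {w | ∃ f : V → Fin 3, IsTRDF G f ∧ weight f = w}

/-- The near total Roman {2}-domination number relative to `v`. -/
noncomputable def gammaNearTR2 (G : SimpleGraph V) (v : V) : ℕ :=
  sInf {w | ∃ f : V → Fin 3, IsNearTR2DF G v f ∧ weight f = w}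

/-- A TR2DF of minimum weight. -/
def IsMinTR2DF (G : SimpleGraph V) (f : V → Fin 3) : Prop :=
  IsTR2DF G f ∧ weight f = gammaTR2 G

/-- A TRDF of minimum weight. -/
def IsMinTRDF (G : SimpleGraph V) (f : V → Fin 3) : Prop :=
  IsTRDF G f ∧ weight f = gammaTR G

/-- Near stable vertex. -/
def IsNearStable (G : SimpleGraph V) (v : V) : Prop := gammaNearTR2 G v = gammaTR2 G

/-- `S_{tR,2}(G)`: the support vertices labelled two by some TRDF of minimum weight. -/
def supportTR2 (G : SimpleGraph V) : Set V :=
  {v | IsSupport G v ∧ ∃ f, IsMinTRDF G f ∧ f v = 2}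

/-- `L_{tR,1}(G)`: the leaves labelled one by some TRDF of minimum weight. -/
def leafTR1 (G : SimpleGraph V) : Set V :=
  {v | IsLeaf G v ∧ ∃ f, IsMinTRDF G f ∧ f v = 1}

/-- `W_0(G)`: the vertices labelled zero by all TR2DFs of minimum weight. -/
def zeroSet (G : SimpleGraph V) : Set V :=
  {v | ∀ f, IsMinTR2DF G f → f v = 0}

/-- `S_1(G)`: the support vertices labelled one by all TR2DFs of minimum weight. -/
def supportOne (G : SimpleGraph V) : Set V :=
  {v | IsSupport G v ∧ ∀ f, IsMinTR2DF G f → f v = 1}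

end Domination

/-! ### Graph constructions -/

section Constructions

/-- The disjoint union of `G` and `H` together with the edge joining `v` and `x`. -/
def joinAt {V W : Type*} (G : SimpleGraph V) (H : SimpleGraph W) (v : V) (x : W) :
    SimpleGraph (V ⊕ W) :=
  (G ⊕g H) ⊔ SimpleGraph.edge (Sum.inl v) (Sum.inr x)

/-- The graph obtained from disjoint copies of `G` and `H` by identifying the vertex `x` of `H` with
the vertex `v` of `G`. The common vertex is `Sum.inl v`. -/
def identifyAt {V W : Type*} (G : SimpleGraph V) (H : SimpleGraph W) (v : V) (x : W) :
    SimpleGraph (V ⊕ {y : W // y ≠ x}) :=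
  SimpleGraph.fromRel fun p q =>
    match p, q with
    | .inl a, .inl b => G.Adj a b
    | .inl a, .inr b => a = v ∧ H.Adj x b
    | .inr _, .inl _ => False
    | .inr a, .inr b => H.Adj a b

/-- The tree `R_r`: `r` disjoint copies of the path `0 - 1 - 2 - 3`, and one more vertex, the centre
`Sum.inl ()`, joined to the support vertex `1` of each copy. -/
def treeR (r : ℕ) : SimpleGraph (Unit ⊕ Fin r × Fin 4) :=
  SimpleGraph.fromRel fun p q =>
    match p, q with
    | .inl _, .inl _ => False
    | .inl _, .inr b => b.2 = 1
    | .inr _, .inl _ => False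
    | .inr a, .inr b => a.1 = b.1 ∧ (SimpleGraph.pathGraph 4).Adj a.2 b.2

end Constructions

/-! ### The family of trees -/

/-- `T` is, up to isomorphism, obtained from `T'` by one of the operations `F_1`, ..., `F_7`. -/
inductive Operation {V W : Type u} [Fintype V] (T' : SimpleGraph V) (T : SimpleGraph W) : Prop
  /-- Join the centre of a tree `R_r` to an arbitrary vertex. -/
  | F1 (r : ℕ) (hr : 1 ≤ r) (v : V) (e : T ≃g joinAt T' (treeR r) v (Sum.inl ()))
  /-- Join a new vertex to a vertex of `S_{tR,2}`. -/
  | F2 (v : V) (hv : v ∈ supportTR2 T') (e : T ≃g joinAt T' (⊥ : SimpleGraph Unit) v ())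
  /-- Join a new vertex to a vertex of `S_1`. -/
  | F3 (v : V) (hv : v ∈ supportOne T') (e : T ≃g joinAt T' (⊥ : SimpleGraph Unit) v ())
  /-- Join a leaf of a path `P_2` to a vertex of `S_adj`. -/
  | F4 (v : V) (hv : v ∈ supportAdj T') (e : T ≃g joinAt T' (SimpleGraph.pathGraph 2) v 0)
  /-- Identify the support vertex of a path `P_3` with a vertex of `L_{tR,1}`. -/
  | F5 (v : V) (hv : v ∈ leafTR1 T') (e : T ≃g identifyAt T' (SimpleGraph.pathGraph 3) v 1)
  /-- Join a leaf of a path `P_2` to a near stable leaf or near stable semi-support vertex. -/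
  | F6 (v : V) (hs : IsNearStable T' v) (hv : IsLeaf T' v ∨ IsSemiSupport T' v)
      (e : T ≃g joinAt T' (SimpleGraph.pathGraph 2) v 0)
  /-- Join a leaf of a path `P_3` to a vertex of `W_0`. -/
  | F7 (v : V) (hv : v ∈ zeroSet T') (e : T ≃g joinAt T' (SimpleGraph.pathGraph 3) v 0)

/-- The family of the graphs obtained from `P_2` by a finite (possibly empty) sequence of
operations `F_1`, ..., `F_7`. -/
inductive FamilyF : {V : Type u} → SimpleGraph V → Prop
  | base {V : Type u} (T : SimpleGraph V) (e : T ≃g SimpleGraph.pathGraph 2) : FamilyF T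
  | step {V W : Type u} [Fintype V] (T' : SimpleGraph V) (T : SimpleGraph W)
      (h' : FamilyF T') (h : Operation T' T) : FamilyF T

end TotalRoman

/-! Both numbers are instances of `domNumber R`, with `R = False` for total Roman {2}-domination and
`R = True` for total Roman domination, and `domNumber False ≤ domNumber True` without isolated
vertices. Write `T'` for the graph before an operation, `T` for the graph after it, and `c` for the
cost of the operation.

From the family to equality: extending a function on `T'` bounds the Roman number of `T` from above
by `domNumber True T' + c`, and cutting the added piece off an arbitrary TR2DF of `T` bounds the
other number from below by `domNumber False T' + c`. The condition on the attachment vertex makes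
the two constants agree, so equality passes from `T'` to `T`.

From equality to the family: by induction on the order it suffices to undo one operation
(`hasReduction`). The inequalities are now read the other way: cutting is applied to TRDFs and
extending to TR2DFs. Equality on `T` closes the chain, which yields equality on `T'` and the
condition on the attachment vertex together. To find a removable piece, root the tree at a leaf and
climb from a deepest vertex. If nothing can be removed, a vertex one level up is a leaf or carries
exactly one leaf, a vertex two levels up may also be the attached support vertex of a `P_4`, and
three levels above a deepest vertex only such copies of `P_4` hang. These form an `R_r`, which can
be removed after all. Operation `F4` never has to be undone, and `F3` only leads from `P_2` to
`P_3`.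

The delicate piece is a pendant star with two leaves, where one must show that removing one leaf or
removing both is tight (`domNumber_addTwoLeaves_le_or`). This rests on a convexity property of
trees, `exists_dominates_midpoint`: twice the cost of label one at a vertex is at most the cost of
label zero with a weakened demand plus the cost of label two. It is proved by strengthening it to a
system of inequalities between seven costs of a rooted tree which is stable under joining two rooted
trees (`CostInv.join`). -/

namespace TotalRoman

open SimpleGraph

/-! ### Inequalities between the costs of rooted trees -/

/-- The numeric inequalities between the seven costs of a rooted tree whose root may be labelled
zero. -/
def FiniteInv (t0 t1 t2 t3 t4 t5 t6 : ℕ) : Prop :=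
  t0 ≤ t1 ∧ t1 ≤ t2 ∧ t3 ≤ t4 ∧ t5 ≤ t6 ∧
    t1 + t3 ≤ t0 + t4 ∧ t1 + t5 ≤ t0 + t4 + 1 ∧ t6 ≤ t5 + 1 ∧ t3 + t3 ≤ t0 + t5 ∧
    t1 + t5 ≤ t0 + t6 ∧ t4 + t4 ≤ t1 + t6 ∧ t1 + t5 ≤ t2 + t2 + 2 ∧ t1 + t4 ≤ t2 + t3 + 1 ∧
    t4 + t6 ≤ t2 + t5 + 1 ∧ t4 + t6 ≤ t3 + t3 + 3 ∧ t5 + t5 ≤ t3 + t6 + 1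

/-- The numeric inequalities between the costs of a rooted tree whose root must be positive. -/
def TopInv (t3 t4 t5 t6 : ℕ) : Prop :=
  t3 ≤ t4 ∧ t5 ≤ t6 ∧ t4 + t5 ≤ t3 + t3 + 2 ∧ t3 + t5 ≤ t4 + t4 + 1

/-- The costs of a rooted tree: a root of label zero is possible, impossible, or the only vertex. -/
def CostInv (t : Fin 7 → ℕ∞) : Prop :=
  (∃ t0 t1 t2 t3 t4 t5 t6 : ℕ, t = ![↑t0, ↑t1, ↑t2, ↑t3, ↑t4, ↑t5, ↑t6] ∧
    FiniteInv t0 t1 t2 t3 t4 t5 t6) ∨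
  (∃ t3 t4 t5 t6 : ℕ, t = ![⊤, ⊤, ⊤, ↑t3, ↑t4, ↑t5, ↑t6] ∧ TopInv t3 t4 t5 t6) ∨
  t = ![0, ⊤, ⊤, 1, ⊤, 2, ⊤]

/-- The costs of the tree obtained by joining the roots of two trees, rooted at the first. -/
noncomputable def joinCost (a b : Fin 7 → ℕ∞) : Fin 7 → ℕ∞ :=
  ![min (a 0 + b 2) (min (a 0 + b 4) (a 0 + b 6)), min (a 1 + b 2) (min (a 0 + b 4) (a 0 + b 6)),
    min (a 2 + b 2) (min (a 1 + b 4) (a 0 + b 6)), min (a 3 + b 1) (min (a 3 + b 3) (a 3 + b 5)),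
    min (a 4 + b 1) (min (a 3 + b 3) (a 3 + b 5)), min (a 5 + b 0) (min (a 5 + b 3) (a 5 + b 5)),
    min (a 6 + b 0) (min (a 5 + b 3) (a 5 + b 5))]

-- Only `t4 + t4 ≤ t1 + t6` is used in the end; the other inequalities make the system reproduce
-- itself under the min-plus recursion. In each goal only the minima on the larger side need a case
-- split, since those on the smaller side lie below each of their terms.
set_option maxHeartbeats 2000000 in
theorem FiniteInv.join {a0 a1 a2 a3 a4 a5 a6 b0 b1 b2 b3 b4 b5 b6 : ℕ}
    (h : FiniteInv a0 a1 a2 a3 a4 a5 a6) (h' : FiniteInv b0 b1 b2 b3 b4 b5 b6)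
    {t0 t1 t2 t3 t4 t5 t6 : ℕ}
    (l0 : t0 ≤ a0 + b2 ∧ t0 ≤ a0 + b4 ∧ t0 ≤ a0 + b6)
    (e0 : t0 = a0 + b2 ∨ t0 = a0 + b4 ∨ t0 = a0 + b6)
    (l1 : t1 ≤ a1 + b2 ∧ t1 ≤ a0 + b4 ∧ t1 ≤ a0 + b6)
    (e1 : t1 = a1 + b2 ∨ t1 = a0 + b4 ∨ t1 = a0 + b6)
    (l2 : t2 ≤ a2 + b2 ∧ t2 ≤ a1 + b4 ∧ t2 ≤ a0 + b6)
    (e2 : t2 = a2 + b2 ∨ t2 = a1 + b4 ∨ t2 = a0 + b6)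
    (l3 : t3 ≤ a3 + b1 ∧ t3 ≤ a3 + b3 ∧ t3 ≤ a3 + b5)
    (e3 : t3 = a3 + b1 ∨ t3 = a3 + b3 ∨ t3 = a3 + b5)
    (l4 : t4 ≤ a4 + b1 ∧ t4 ≤ a3 + b3 ∧ t4 ≤ a3 + b5)
    (e4 : t4 = a4 + b1 ∨ t4 = a3 + b3 ∨ t4 = a3 + b5)
    (l5 : t5 ≤ a5 + b0 ∧ t5 ≤ a5 + b3 ∧ t5 ≤ a5 + b5)
    (e5 : t5 = a5 + b0 ∨ t5 = a5 + b3 ∨ t5 = a5 + b5)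
    (l6 : t6 ≤ a6 + b0 ∧ t6 ≤ a5 + b3 ∧ t6 ≤ a5 + b5)
    (e6 : t6 = a6 + b0 ∨ t6 = a5 + b3 ∨ t6 = a5 + b5) :
    FiniteInv t0 t1 t2 t3 t4 t5 t6 := by
  simp only [FiniteInv] at h h' ⊢
  refine ⟨?_, ?_, ?_, ?_, ?_, ?_, ?_, ?_, ?_, ?_, ?_, ?_, ?_, ?_, ?_⟩
  · clear e0; rcases e1 with e | e | e <;> clear e2 e3 e4 e5 e6 <;> omega
  · clear e0 e1 e3 e4 e5 e6; rcases e2 with e | e | e <;> omega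
  · clear e0 e1 e2 e3 e5 e6; rcases e4 with e | e | e <;> omega
  · clear e0 e1 e2 e3 e5 e4; rcases e6 with e | e | e <;> omega
  · clear e1 e2 e3 e5 e6; rcases e0 with e | e | e <;> rcases e4 with f | f | f <;> omega
  · clear e1 e2 e3 e5 e6; rcases e0 with e | e | e <;> rcases e4 with f | f | f <;> omega
  · clear e1 e2 e3 e0 e4 e6; rcases e5 with e | e | e <;> omega
  · clear e1 e2 e3 e4 e6; rcases e0 with e | e | e <;> rcases e5 with f | f | f <;> omega
  · clear e1 e2 e3 e4 e5; rcases e0 with e | e | e <;> rcases e6 with f | f | f <;> omega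
  · clear e0 e2 e3 e4 e5; rcases e1 with e | e | e <;> rcases e6 with f | f | f <;> omega
  · clear e0 e1 e3 e4 e5 e6; rcases e2 with e | e | e <;> omega
  · clear e0 e1 e4 e5 e6; rcases e2 with e | e | e <;> rcases e3 with f | f | f <;> omega
  · clear e0 e1 e3 e4 e6; rcases e2 with e | e | e <;> rcases e5 with f | f | f <;> omega
  · clear e0 e1 e2 e4 e5 e6; rcases e3 with e | e | e <;> omega
  · clear e0 e1 e2 e4 e5; rcases e3 with e | e | e <;> rcases e6 with f | f | f <;> omega

theorem natCast_min_enat (x y : ℕ) : ((min x y : ℕ) : ℕ∞) = min (x : ℕ∞) y :=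
  (Nat.mono_cast (α := ℕ∞)).map_min

-- A single vertex as second tree is a leaf next to the root and rules out label zero there. Any
-- other second tree allows label zero, unless the first tree already forbids it.
set_option maxHeartbeats 2000000 in
theorem CostInv.join {a b : Fin 7 → ℕ∞} (ha : CostInv a) (hb : CostInv b) :
    CostInv (joinCost a b) := by
  rcases ha with ⟨a0, a1, a2, a3, a4, a5, a6, rfl, ha⟩ | ⟨a3, a4, a5, a6, rfl, ha⟩ | rfl
  · rcases hb with ⟨b0, b1, b2, b3, b4, b5, b6, rfl, hb⟩ | ⟨b3, b4, b5, b6, rfl, hb⟩ | rfl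
    · left
      refine ⟨min (a0 + b2) (min (a0 + b4) (a0 + b6)), min (a1 + b2) (min (a0 + b4) (a0 + b6)),
        min (a2 + b2) (min (a1 + b4) (a0 + b6)), min (a3 + b1) (min (a3 + b3) (a3 + b5)),
        min (a4 + b1) (min (a3 + b3) (a3 + b5)), min (a5 + b0) (min (a5 + b3) (a5 + b5)),
        min (a6 + b0) (min (a5 + b3) (a5 + b5)), ?_, ?_⟩
      · simp only [natCast_min_enat, Nat.cast_add]
        simp [joinCost]
      · apply FiniteInv.join ha hb <;> omega
    · left
      refine ⟨min (a0 + b4) (a0 + b6), min (a0 + b4) (a0 + b6),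
        min (a1 + b4) (a0 + b6), min (a3 + b3) (a3 + b5),
        min (a3 + b3) (a3 + b5), min (a5 + b3) (a5 + b5),
        min (a5 + b3) (a5 + b5), ?_, ?_⟩
      · simp only [natCast_min_enat, Nat.cast_add]
        simp [joinCost]
      · simp only [FiniteInv, TopInv] at *
        omega
    · right; left
      refine ⟨a3 + 1, a3 + 1, a5, min a6 (a5 + 1), ?_, ?_⟩
      · simp [joinCost]
        norm_cast
      · simp only [FiniteInv, TopInv] at *
        omega
  · rcases hb with ⟨b0, b1, b2, b3, b4, b5, b6, rfl, hb⟩ | ⟨b3, b4, b5, b6, rfl, hb⟩ | rfl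
    · right; left
      refine ⟨min (a3 + b1) (min (a3 + b3) (a3 + b5)),
        min (a4 + b1) (min (a3 + b3) (a3 + b5)), min (a5 + b0) (min (a5 + b3) (a5 + b5)),
        min (a6 + b0) (min (a5 + b3) (a5 + b5)), ?_, ?_⟩
      · simp only [natCast_min_enat, Nat.cast_add]
        simp [joinCost]
      · simp only [FiniteInv, TopInv] at *
        omega
    · right; left
      refine ⟨min (a3 + b3) (a3 + b5),
        min (a3 + b3) (a3 + b5), min (a5 + b3) (a5 + b5),
        min (a5 + b3) (a5 + b5), ?_, ?_⟩
      · simp only [natCast_min_enat, Nat.cast_add]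
        simp [joinCost]
      · simp only [TopInv] at *
        omega
    · right; left
      refine ⟨a3 + 1, a3 + 1, a5, min a6 (a5 + 1), ?_, ?_⟩
      · simp [joinCost]
        norm_cast
      · simp only [TopInv] at *
        omega
  · rcases hb with ⟨b0, b1, b2, b3, b4, b5, b6, rfl, hb⟩ | ⟨b3, b4, b5, b6, rfl, hb⟩ | rfl
    · left
      refine ⟨min b2 (min b4 b6), min b4 b6, b6, min (1 + b1) (min (1 + b3) (1 + b5)),
        min (1 + b3) (1 + b5), min (2 + b0) (min (2 + b3) (2 + b5)),
        min (2 + b3) (2 + b5), ?_, ?_⟩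
      · simp only [natCast_min_enat, Nat.cast_add]
        simp [joinCost]
      · simp only [FiniteInv] at *
        omega
    · left
      refine ⟨min b4 b6, min b4 b6, b6, min (1 + b3) (1 + b5),
        min (1 + b3) (1 + b5), min (2 + b3) (2 + b5),
        min (2 + b3) (2 + b5), ?_, ?_⟩
      · simp only [natCast_min_enat, Nat.cast_add]
        simp [joinCost]
      · simp only [FiniteInv, TopInv] at *
        omega
    · right; left
      refine ⟨2, 2, 2, 3, ?_, ?_⟩
      · simp [joinCost]
        norm_num
      · simp only [TopInv]
        omega

/-! ### Leaves and isolated vertices -/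

section Graphs

variable {V W : Type*} {G : SimpleGraph V} {H : SimpleGraph W} {v w y : V}

/-- No vertex is isolated. -/
def NoIsolated (G : SimpleGraph V) : Prop := ∀ v, ∃ w, G.Adj v w

theorem NoIsolated.of_iso (h : NoIsolated H) (e : G ≃g H) : NoIsolated G := by
  intro v
  obtain ⟨w, hw⟩ := h (e v)
  refine ⟨e.symm w, ?_⟩
  rw [← e.map_adj_iff]
  simpa using hw

theorem isLeaf_iff : IsLeaf G v ↔ ∃ w, ∀ x, G.Adj v x ↔ x = w := by
  simp only [IsLeaf, Set.ncard_eq_one, Set.ext_iff, mem_neighborSet, Set.mem_singleton_iff]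

theorem IsLeaf.eq_of_adj (h : IsLeaf G v) (hw : G.Adj v w) (hy : G.Adj v y) : w = y := by
  obtain ⟨z, hz⟩ := isLeaf_iff.1 h
  rw [(hz w).1 hw, (hz y).1 hy]

theorem isLeaf_of_forall (hw : G.Adj v w) (h : ∀ x, G.Adj v x → x = w) : IsLeaf G v :=
  isLeaf_iff.2 ⟨w, fun x => ⟨h x, fun hx => hx ▸ hw⟩⟩

theorem IsLeaf.adj_iff (h : IsLeaf G v) (hw : G.Adj v w) {x : V} : G.Adj v x ↔ x = w :=
  ⟨fun hx => h.eq_of_adj hx hw, fun hx => hx ▸ hw⟩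

end Graphs

/-! ### A common framework for the two domination numbers -/

section Basics

variable {V W : Type*} [Fintype V] [Fintype W] {G : SimpleGraph V} {H : SimpleGraph W}
  {f g : V → Fin 3} {v w y : V}

theorem le_nbrWeight (h : G.Adj v w) : (f w : ℕ) ≤ nbrWeight G f v := by
  classical
  exact Finset.single_le_sum (f := fun x => (f x : ℕ)) (fun _ _ => Nat.zero_le _) (by simp [h])

theorem nbrWeight_pos : 0 < nbrWeight G f v ↔ ∃ x, G.Adj v x ∧ 0 < (f x : ℕ) := by
  classical
  rw [nbrWeight, Finset.sum_pos_iff]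
  simp

theorem nbrWeight_le_of_le (h : ∀ x, G.Adj v x → (f x : ℕ) ≤ g x) :
    nbrWeight G f v ≤ nbrWeight G g v := by
  classical
  exact Finset.sum_le_sum fun x hx => h x (by simpa using hx)

theorem nbrWeight_eq_of_unique (h : ∀ x, G.Adj v x ↔ x = w) : nbrWeight G f v = f w := by
  classical
  rw [nbrWeight, Finset.sum_eq_single_of_mem w (by simp [h])]
  intro b hb hne
  exact absurd ((h b).1 (by simpa using hb)) hne

theorem fin_three_le_two (a : Fin 3) : (a : ℕ) ≤ 2 := by omega

theorem weight_update [DecidableEq V] (f : V → Fin 3) (v : V) (a : Fin 3) :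
    weight (Function.update f v a) + f v = weight f + a := by
  have h1 := Finset.add_sum_erase Finset.univ (fun x => (f x : ℕ)) (Finset.mem_univ v)
  have h2 := Finset.add_sum_erase Finset.univ (fun x => (Function.update f v a x : ℕ))
    (Finset.mem_univ v)
  have h3 : ∑ x ∈ Finset.univ.erase v, (Function.update f v a x : ℕ) =
      ∑ x ∈ Finset.univ.erase v, (f x : ℕ) :=
    Finset.sum_congr rfl fun x hx => by rw [Function.update_of_ne (Finset.ne_of_mem_erase hx)]
  simp only [Function.update_self] at h2
  simp only [weight]
  omega

/-- The vertex `v` is totally dominated and, if labelled zero, has neighbour weight at least two;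
in the Roman case `R` it then even has a neighbour labelled two. -/
def DomAt (R : Prop) (G : SimpleGraph V) (f : V → Fin 3) (v : V) : Prop :=
  0 < nbrWeight G f v ∧
    ((f v : ℕ) = 0 → 2 ≤ nbrWeight G f v ∧ (R → ∃ x, G.Adj v x ∧ (f x : ℕ) = 2))

/-- Every vertex is dominated: `Dominates False` is a TR2DF, `Dominates True` a TRDF. -/
def Dominates (R : Prop) (G : SimpleGraph V) (f : V → Fin 3) : Prop := ∀ v, DomAt R G f v

theorem isTR2DF_iff : IsTR2DF G f ↔ Dominates False G f := by
  simp only [IsTR2DF, IsR2DF, IsDF, IsTDF, Dominates, DomAt, nbrWeight_pos, ← Fin.val_pos_iff]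
  constructor
  · rintro ⟨⟨-, h2⟩, h3⟩ v
    exact ⟨h3 v, fun h => ⟨h2 v (Fin.ext h), False.elim⟩⟩
  · intro h
    exact ⟨⟨fun v _ => (h v).1, fun v hv => ((h v).2 (by simp [hv])).1⟩, fun v => (h v).1⟩

theorem isTRDF_iff : IsTRDF G f ↔ Dominates True G f := by
  simp only [IsTRDF, IsTDF, Dominates, DomAt, nbrWeight_pos, ← Fin.val_pos_iff]
  constructor
  · rintro ⟨h1, h2⟩ v
    refine ⟨h1 v, fun h => ?_⟩
    obtain ⟨x, hx, hx2⟩ := h2 v (Fin.ext h)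
    exact ⟨le_trans (by simp [hx2]) (le_nbrWeight hx), fun _ => ⟨x, hx, by simp [hx2]⟩⟩
  · intro h
    refine ⟨fun v => (h v).1, fun v hv => ?_⟩
    obtain ⟨x, hx, hx2⟩ := ((h v).2 (by simp [hv])).2 trivial
    exact ⟨x, hx, Fin.ext hx2⟩

/-- Larger labels around `v` can only help; a neighbour labelled two keeps its label because two is
the maximum. -/
theorem DomAt.of_le {R : Prop} (h : DomAt R G f v) (hle : ∀ x, G.Adj v x → (f x : ℕ) ≤ g x)
    (h0 : (g v : ℕ) = 0 → (f v : ℕ) = 0) : DomAt R G g v := by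
  have := nbrWeight_le_of_le hle
  refine ⟨h.1.trans_le this, fun hv => ⟨(h.2 (h0 hv)).1.trans this, fun hR => ?_⟩⟩
  obtain ⟨x, hx, hx2⟩ := (h.2 (h0 hv)).2 hR
  exact ⟨x, hx, le_antisymm (fin_three_le_two _) (hx2 ▸ hle x hx)⟩

theorem domAt_of_pos {R : Prop} (h : 0 < (g v : ℕ)) (hw : G.Adj v w) (hp : 0 < (g w : ℕ)) :
    DomAt R G g v :=
  ⟨nbrWeight_pos.2 ⟨w, hw, hp⟩, fun h' => by omega⟩

theorem domAt_of_two {R : Prop} (hw : G.Adj v w) (hp : (g w : ℕ) = 2) : DomAt R G g v :=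
  ⟨nbrWeight_pos.2 ⟨w, hw, by omega⟩, fun _ => ⟨hp ▸ le_nbrWeight hw, fun _ => ⟨w, hw, hp⟩⟩⟩

theorem DomAt.mono {R R' : Prop} (h : DomAt R G f v) (hR : R' → R) : DomAt R' G f v :=
  ⟨h.1, fun h0 => ⟨(h.2 h0).1, fun r => (h.2 h0).2 (hR r)⟩⟩

/-- The minimum weight of a function that dominates `G`. -/
noncomputable def domNumber (R : Prop) (G : SimpleGraph V) : ℕ :=
  sInf {w | ∃ f : V → Fin 3, Dominates R G f ∧ weight f = w}

theorem gammaTR2_eq : gammaTR2 G = domNumber False G := by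
  simp only [gammaTR2, domNumber, isTR2DF_iff]

theorem gammaTR_eq : gammaTR G = domNumber True G := by
  simp only [gammaTR, domNumber, isTRDF_iff]

theorem domNumber_le {R : Prop} (h : Dominates R G f) : domNumber R G ≤ weight f :=
  Nat.sInf_le ⟨f, h, rfl⟩

theorem dominates_const_one {R : Prop} (hG : NoIsolated G) : Dominates R G fun _ => 1 := by
  intro v
  obtain ⟨w, hw⟩ := hG v
  exact domAt_of_pos (by simp) hw (by simp)

/-- The constant one is admissible when no vertex is isolated, so the infimum runs over a nonempty
set and is not the default value `0`. -/
theorem exists_dominates_weight_eq (R : Prop) (hG : NoIsolated G) :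
    ∃ f, Dominates R G f ∧ weight f = domNumber R G :=
  Nat.sInf_mem (s := {w | ∃ f : V → Fin 3, Dominates R G f ∧ weight f = w})
    ⟨_, _, dominates_const_one hG, rfl⟩

theorem le_domNumber {R : Prop} {k : ℕ} (hG : NoIsolated G)
    (h : ∀ f, Dominates R G f → k ≤ weight f) : k ≤ domNumber R G := by
  obtain ⟨f, hf, hw⟩ := exists_dominates_weight_eq R hG
  exact hw ▸ h f hf

theorem domNumber_mono {R R' : Prop} (hG : NoIsolated G) (hR : R' → R) :
    domNumber R' G ≤ domNumber R G :=
  le_domNumber hG fun _ hf => domNumber_le fun v => (hf v).mono hR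

theorem isMinTR2DF_iff : IsMinTR2DF G f ↔ Dominates False G f ∧ weight f = domNumber False G := by
  rw [IsMinTR2DF, isTR2DF_iff, gammaTR2_eq]

theorem isMinTRDF_iff : IsMinTRDF G f ↔ Dominates True G f ∧ weight f = domNumber True G := by
  rw [IsMinTRDF, isTRDF_iff, gammaTR_eq]

theorem weight_comp_equiv (e : V ≃ W) (f : W → Fin 3) : weight (f ∘ e) = weight f :=
  Equiv.sum_comp e fun x => (f x : ℕ)

theorem nbrWeight_comp_iso (e : G ≃g H) (f : W → Fin 3) (v : V) :
    nbrWeight G (f ∘ e) v = nbrWeight H f (e v) := by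
  classical
  refine Finset.sum_bij' (fun x _ => e x) (fun x _ => e.symm x) ?_ ?_ ?_ ?_ ?_ <;> simp [e.map_adj_iff]
  intro a ha
  rw [← e.map_adj_iff]
  simpa using ha

theorem Dominates.comp_iso {R : Prop} {f : W → Fin 3} (h : Dominates R H f) (e : G ≃g H) :
    Dominates R G (f ∘ e) := by
  intro v
  have := h (e v)
  refine ⟨by rw [nbrWeight_comp_iso]; exact this.1, fun h0 => ⟨?_, fun hR => ?_⟩⟩
  · rw [nbrWeight_comp_iso]; exact (this.2 h0).1
  · obtain ⟨x, hx, hx2⟩ := (this.2 h0).2 hR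
    refine ⟨e.symm x, ?_, by simpa using hx2⟩
    rw [← e.map_adj_iff]
    simpa using hx

theorem domNumber_congr (R : Prop) (e : G ≃g H) : domNumber R G = domNumber R H := by
  unfold domNumber
  congr 1
  ext w
  constructor
  · rintro ⟨f, hf, rfl⟩
    exact ⟨f ∘ e.symm, hf.comp_iso e.symm, weight_comp_equiv e.symm.toEquiv f⟩
  · rintro ⟨f, hf, rfl⟩
    exact ⟨f ∘ e, hf.comp_iso e, weight_comp_equiv e.toEquiv f⟩

theorem noIsolated_of_connected (hG : G.Connected) (hn : 2 ≤ Fintype.card V) : NoIsolated G := by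
  intro v
  have : Nontrivial V := Fintype.one_lt_card_iff_nontrivial.1 hn
  exact hG.preconnected.exists_adj_of_nontrivial v

theorem IsLeaf.nbrWeight_eq (h : IsLeaf G v) (hw : G.Adj v w) : nbrWeight G f v = f w :=
  nbrWeight_eq_of_unique fun _ => h.adj_iff hw

theorem Dominates.pos_of_isSupport {R : Prop} (hf : Dominates R G f) (hv : IsSupport G v) :
    0 < (f v : ℕ) := by
  obtain ⟨h, hadj, hl⟩ := hv
  have := (hf h).1
  rwa [hl.nbrWeight_eq hadj.symm] at this

/-- A leaf labelled zero needs weight two from its only neighbour. Hence an edge at a leaf always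
weighs at least two, the source of most lower bounds below. -/
theorem Dominates.eq_two_or_of_isLeaf {R : Prop} (hf : Dominates R G f) (h : G.Adj v w)
    (hl : IsLeaf G w) : (f v : ℕ) = 2 ∨ (f v : ℕ) = 1 ∧ 0 < (f w : ℕ) := by
  have h1 := hf w
  rw [DomAt, hl.nbrWeight_eq h.symm] at h1
  have := fin_three_le_two (f v)
  by_cases h0 : (f w : ℕ) = 0
  · have := (h1.2 h0).1
    omega
  · omega

end Basics

/-! ### Domination in two graphs joined by an edge -/

section Join

variable {V W : Type*} {G : SimpleGraph V} {H : SimpleGraph W} {v : V} {x : W}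

@[simp] theorem joinAt_adj_inl_inl {a b : V} :
    (joinAt G H v x).Adj (.inl a) (.inl b) ↔ G.Adj a b := by
  simp [joinAt, edge_adj]

@[simp] theorem joinAt_adj_inr_inr {a b : W} :
    (joinAt G H v x).Adj (.inr a) (.inr b) ↔ H.Adj a b := by
  simp [joinAt, edge_adj]

@[simp] theorem joinAt_adj_inl_inr {a : V} {b : W} :
    (joinAt G H v x).Adj (.inl a) (.inr b) ↔ a = v ∧ b = x := by
  simp [joinAt, edge_adj]

@[simp] theorem joinAt_adj_inr_inl {a : V} {b : W} :
    (joinAt G H v x).Adj (.inr b) (.inl a) ↔ a = v ∧ b = x := by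
  rw [adj_comm, joinAt_adj_inl_inr]

theorem NoIsolated.joinAt_bot (hG : NoIsolated G) : NoIsolated (joinAt G (⊥ : SimpleGraph Unit) v ()) := by
  rintro (a | a)
  · obtain ⟨b, hb⟩ := hG a
    exact ⟨.inl b, by simpa using hb⟩
  · exact ⟨.inl v, by simp⟩

theorem NoIsolated.joinAt (hG : NoIsolated G) (hH : NoIsolated H) : NoIsolated (joinAt G H v x) := by
  rintro (a | a)
  · obtain ⟨b, hb⟩ := hG a
    exact ⟨.inl b, by simpa using hb⟩
  · obtain ⟨b, hb⟩ := hH a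
    exact ⟨.inr b, by simpa using hb⟩

variable [Fintype V] [Fintype W] {f : V ⊕ W → Fin 3}

theorem weight_sum (f : V ⊕ W → Fin 3) : weight f = weight (f ∘ Sum.inl) + weight (f ∘ Sum.inr) := by
  simp [weight, Fintype.sum_sum_type]

open scoped Classical in
theorem nbrWeight_joinAt_inl (a : V) : nbrWeight (joinAt G H v x) f (.inl a) =
    nbrWeight G (f ∘ Sum.inl) a + if a = v then (f (.inr x) : ℕ) else 0 := by
  simp only [nbrWeight, Finset.sum_filter, Fintype.sum_sum_type, joinAt_adj_inl_inl,
    joinAt_adj_inl_inr, Function.comp]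
  congr 1
  by_cases h : a = v <;> simp [h]

open scoped Classical in
theorem nbrWeight_joinAt_inr (b : W) : nbrWeight (joinAt G H v x) f (.inr b) =
    nbrWeight H (f ∘ Sum.inr) b + if b = x then (f (.inl v) : ℕ) else 0 := by
  simp only [nbrWeight, Finset.sum_filter, Fintype.sum_sum_type, joinAt_adj_inr_inl,
    joinAt_adj_inr_inr, Function.comp]
  rw [add_comm]
  congr 1
  by_cases h : b = x <;> simp [h]

theorem nbrWeight_joinAt_inl_self : nbrWeight (joinAt G H v x) f (.inl v) =
    nbrWeight G (f ∘ Sum.inl) v + f (.inr x) := by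
  classical
  simp [nbrWeight_joinAt_inl]

theorem nbrWeight_joinAt_inl_of_ne {a : V} (h : a ≠ v) : nbrWeight (joinAt G H v x) f (.inl a) =
    nbrWeight G (f ∘ Sum.inl) a := by
  classical
  simp [nbrWeight_joinAt_inl, h]

theorem nbrWeight_joinAt_inr_self : nbrWeight (joinAt G H v x) f (.inr x) =
    nbrWeight H (f ∘ Sum.inr) x + f (.inl v) := by
  classical
  simp [nbrWeight_joinAt_inr]

theorem nbrWeight_joinAt_inr_of_ne {b : W} (h : b ≠ x) : nbrWeight (joinAt G H v x) f (.inr b) =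
    nbrWeight H (f ∘ Sum.inr) b := by
  classical
  simp [nbrWeight_joinAt_inr, h]

theorem domAt_joinAt_inl_of_ne {R : Prop} {a : V} (h : a ≠ v) :
    DomAt R (joinAt G H v x) f (.inl a) ↔ DomAt R G (f ∘ Sum.inl) a := by
  simp [DomAt, nbrWeight_joinAt_inl_of_ne h, h]

theorem domAt_joinAt_inr_of_ne {R : Prop} {b : W} (h : b ≠ x) :
    DomAt R (joinAt G H v x) f (.inr b) ↔ DomAt R H (f ∘ Sum.inr) b := by
  simp [DomAt, nbrWeight_joinAt_inr_of_ne h, h]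

theorem domAt_joinAt_inl_self {R : Prop} : DomAt R (joinAt G H v x) f (.inl v) ↔
    0 < nbrWeight G (f ∘ Sum.inl) v + f (.inr x) ∧
    ((f (.inl v) : ℕ) = 0 → 2 ≤ nbrWeight G (f ∘ Sum.inl) v + f (.inr x) ∧
      (R → (∃ y, G.Adj v y ∧ (f (.inl y) : ℕ) = 2) ∨ (f (.inr x) : ℕ) = 2)) := by
  simp [DomAt, nbrWeight_joinAt_inl_self]

theorem domAt_joinAt_inr_self {R : Prop} : DomAt R (joinAt G H v x) f (.inr x) ↔
    0 < nbrWeight H (f ∘ Sum.inr) x + f (.inl v) ∧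
    ((f (.inr x) : ℕ) = 0 → 2 ≤ nbrWeight H (f ∘ Sum.inr) x + f (.inl v) ∧
      (R → (∃ y, H.Adj x y ∧ (f (.inr y) : ℕ) = 2) ∨ (f (.inl v) : ℕ) = 2)) := by
  simp [DomAt, nbrWeight_joinAt_inr_self, or_comm]

theorem DomAt.joinAt_inl {R : Prop} {a : V} (h : DomAt R G (f ∘ Sum.inl) a) :
    DomAt R (joinAt G H v x) f (.inl a) := by
  by_cases ha : a = v
  · subst ha
    rw [domAt_joinAt_inl_self]
    refine ⟨by have := h.1; omega, fun h0 => ⟨by have := (h.2 h0).1; omega, fun hR => .inl ?_⟩⟩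
    exact (h.2 h0).2 hR
  · rwa [domAt_joinAt_inl_of_ne ha]

end Join

/-! ### Adding a leaf at a support vertex (`F2`, `F3`) -/

section AddLeaf

variable {V : Type*} [Fintype V] {G : SimpleGraph V} {v h u y : V} {R : Prop}

/-- The graph obtained from `G` by adding a new leaf at `v`. -/
abbrev addLeaf (G : SimpleGraph V) (v : V) : SimpleGraph (V ⊕ Unit) :=
  joinAt G (⊥ : SimpleGraph Unit) v ()

theorem isLeaf_addLeaf_inr : IsLeaf (addLeaf G v) (.inr ()) :=
  isLeaf_of_forall (w := .inl v) (by simp) (by rintro (a | a) <;> simp)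

theorem weight_unit (f : Unit → Fin 3) : weight f = f () := by simp [weight]

theorem Dominates.addLeaf_zero {g : V → Fin 3} (hg : Dominates R G g) (hv : (g v : ℕ) = 2) :
    Dominates R (addLeaf G v) (Sum.elim g fun _ => 0) := by
  rintro (a | a)
  · exact DomAt.joinAt_inl (by simpa using hg a)
  · exact domAt_of_two (w := .inl v) (by simp) (by simpa using hv)

theorem weight_addLeaf_elim (g : V → Fin 3) (a : Fin 3) :
    weight (Sum.elim g fun _ : Unit => a) = weight g + a := by
  rw [weight_sum, weight_unit]
  rfl

/-- Now `v` has two leaves, so it has label two, or label one with both leaves positive. In the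
second case the weight, at least three, can be rearranged as two on `v` and one on `h`. -/
theorem Dominates.addLeaf_restrict (hadj : G.Adj v h) (hl : IsLeaf G h) {f : V ⊕ Unit → Fin 3}
    (hf : Dominates R (addLeaf G v) f) :
    ∃ f', Dominates R G f' ∧ (f' v : ℕ) = 2 ∧ weight f' ≤ weight f := by
  classical
  have hvh : v ≠ h := hadj.ne
  have hnew := hf.eq_two_or_of_isLeaf (v := .inl v) (w := .inr ()) (by simp) isLeaf_addLeaf_inr
  have hh : (f (.inl v) : ℕ) = 2 ∨ (f (.inl v) : ℕ) = 1 ∧ 0 < (f (.inl h) : ℕ) := by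
    refine hf.eq_two_or_of_isLeaf (by simpa using hadj) (isLeaf_of_forall (w := .inl v)
      (by simpa using hadj.symm) ?_)
    rintro (a | a)
    · simpa using fun ha => hl.eq_of_adj ha hadj.symm
    · simp [hvh.symm]
  -- The new label of `h`. It may be zero only if both leaves are zero, for then `v` has a positive
  -- neighbour elsewhere in `G`.
  obtain ⟨c, hc⟩ : ∃ c : Fin 3, ((c : ℕ) = 0 ∧ (f (.inl h) : ℕ) = 0 ∧ (f (.inr ()) : ℕ) = 0) ∨
      ((c : ℕ) = 1 ∧ 0 < (f (.inl h) : ℕ) + f (.inr ())) := by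
    by_cases h0 : (f (.inl h) : ℕ) = 0 ∧ (f (.inr ()) : ℕ) = 0
    · exact ⟨0, .inl ⟨rfl, h0⟩⟩
    · exact ⟨1, .inr ⟨rfl, by omega⟩⟩
  have hfv := hf (.inl v)
  rw [domAt_joinAt_inl_self] at hfv
  refine ⟨Function.update (Function.update (f ∘ Sum.inl) h c) v 2, fun a => ?_, by simp, ?_⟩
  · by_cases hav : a = v
    · subst hav
      rcases hc with ⟨hc0, hc1, hc2⟩ | ⟨hc0, -⟩
      · obtain ⟨z, hz, hz0⟩ := nbrWeight_pos.1 (show 0 < nbrWeight G (f ∘ Sum.inl) a by omega)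
        have hzh : z ≠ h := by
          rintro rfl
          simp only [Function.comp] at hz0
          omega
        exact domAt_of_pos (by simp) hz (by simpa [hz.ne', hzh] using hz0)
      · exact domAt_of_pos (by simp) hadj (by simp [hvh.symm, hc0])
    · by_cases hah : a = h
      · subst hah
        exact domAt_of_two hadj.symm (by simp)
      · have := hf (.inl a)
        rw [domAt_joinAt_inl_of_ne hav] at this
        refine this.of_le (fun z hz => ?_) (by simp [hav, hah])
        have hzh : z ≠ h := by
          rintro rfl
          exact hav (hl.eq_of_adj hz.symm hadj.symm)
        by_cases hzv : z = v
        · subst hzv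
          simpa using fin_three_le_two _
        · simp [hzv, hzh]
  · have h1 := weight_update (Function.update (f ∘ Sum.inl) h c) v 2
    have h2 := weight_update (f ∘ Sum.inl) h c
    rw [Function.update_of_ne hvh] at h1
    have h3 := weight_sum f
    rw [weight_unit] at h3
    simp only [Function.comp] at h1 h2 h3
    have : ((2 : Fin 3) : ℕ) = 2 := rfl
    omega

theorem domNumber_le_addLeaf (hG : NoIsolated G) (hv : IsSupport G v) :
    domNumber R G ≤ domNumber R (addLeaf G v) := by
  obtain ⟨h, hadj, hl⟩ := hv
  refine le_domNumber hG.joinAt_bot fun f hf => ?_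
  obtain ⟨f', hf', -, hw⟩ := hf.addLeaf_restrict hadj hl
  exact (domNumber_le hf').trans hw

theorem mem_supportTR2_iff : v ∈ supportTR2 G ↔ IsSupport G v ∧
    ∃ f, Dominates True G f ∧ weight f = domNumber True G ∧ (f v : ℕ) = 2 := by
  simp only [supportTR2, Set.mem_ofPred_eq, isMinTRDF_iff, Fin.ext_iff, and_assoc]
  rfl

theorem mem_supportOne_iff : v ∈ supportOne G ↔ IsSupport G v ∧
    ∀ f, Dominates False G f → weight f = domNumber False G → (f v : ℕ) = 1 := by
  simp only [supportOne, Set.mem_ofPred_eq, isMinTR2DF_iff, Fin.ext_iff, and_imp]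
  rfl

theorem mem_leafTR1_iff : v ∈ leafTR1 G ↔ IsLeaf G v ∧
    ∃ f, Dominates True G f ∧ weight f = domNumber True G ∧ (f v : ℕ) = 1 := by
  simp only [leafTR1, Set.mem_ofPred_eq, isMinTRDF_iff, Fin.ext_iff, and_assoc]
  rfl

theorem mem_zeroSet_iff : v ∈ zeroSet G ↔
    ∀ f, Dominates False G f → weight f = domNumber False G → (f v : ℕ) = 0 := by
  simp only [zeroSet, Set.mem_ofPred_eq, isMinTR2DF_iff, Fin.ext_iff, and_imp]
  rfl

/-- A minimum TRDF with label two on `v` extends by zero, so both numbers of the larger graph lie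
between `domNumber False G` and `domNumber True G`. -/
theorem domNumber_eq_addLeaf_of_mem_supportTR2 (hG : NoIsolated G)
    (he : domNumber False G = domNumber True G) (hv : v ∈ supportTR2 G) :
    domNumber False (addLeaf G v) = domNumber True (addLeaf G v) := by
  obtain ⟨hs, f, hf, hw, h2⟩ := mem_supportTR2_iff.1 hv
  have h1 := domNumber_le (hf.addLeaf_zero h2)
  rw [weight_addLeaf_elim] at h1
  have h3 := domNumber_le_addLeaf (R := False) hG hs
  have h4 := domNumber_mono (G := addLeaf G v) hG.joinAt_bot (False.elim : False → True)
  simp only [Fin.val_zero] at h1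
  omega

/-- The same chain closed from the other side; the restriction of a minimum TRDF of the larger graph
is the required witness with label two on `v`. -/
theorem mem_supportTR2_of_addLeaf (hG : NoIsolated G) (hv : IsSupport G v)
    (hle : domNumber False (addLeaf G v) ≤ domNumber False G)
    (he : domNumber False (addLeaf G v) = domNumber True (addLeaf G v)) :
    domNumber False G = domNumber True G ∧ v ∈ supportTR2 G := by
  have h1 := domNumber_le_addLeaf (R := True) hG hv
  have h2 := domNumber_mono hG (False.elim : False → True)
  refine ⟨by omega, mem_supportTR2_iff.2 ⟨hv, ?_⟩⟩
  obtain ⟨h, hadj, hl⟩ := hv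
  obtain ⟨f, hf, hw⟩ := exists_dominates_weight_eq True
    (show NoIsolated (addLeaf G v) from hG.joinAt_bot)
  obtain ⟨f', hf', hf2, hw'⟩ := hf.addLeaf_restrict hadj hl
  have := domNumber_le hf'
  exact ⟨f', hf', by omega, hf2⟩

/-- The other positive neighbour `y` keeps `v` totally dominated, so the weight of the leaf `h` can
be moved onto `v`. -/
theorem Dominates.exists_eq_two {g : V → Fin 3} (hg : Dominates R G g)
    (hadj : G.Adj v h) (hl : IsLeaf G h) (hy : G.Adj v y) (hyh : y ≠ h) (hpos : 0 < (g y : ℕ)) :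
    ∃ g', Dominates R G g' ∧ (g' v : ℕ) = 2 ∧ weight g' ≤ weight g := by
  classical
  rcases hg.eq_two_or_of_isLeaf hadj hl with h2 | ⟨h1, h0⟩
  · exact ⟨g, hg, h2, le_rfl⟩
  refine ⟨Function.update (Function.update g h 0) v 2, fun a => ?_, by simp, ?_⟩
  · by_cases hav : a = v
    · subst hav
      exact domAt_of_pos (by simp) hy (by simpa [hyh, hy.ne'] using hpos)
    · by_cases hah : a = h
      · subst hah
        exact domAt_of_two hadj.symm (by simp)
      · refine (hg a).of_le (fun z hz => ?_) (by simp [hav, hah])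
        have hzh : z ≠ h := by
          rintro rfl
          exact hav (hl.eq_of_adj hz.symm hadj.symm)
        by_cases hzv : z = v
        · subst hzv
          simpa using fin_three_le_two _
        · simp [hzv, hzh]
  · have h3 := weight_update (Function.update g h 0) v 2
    have h4 := weight_update g h 0
    rw [Function.update_of_ne hadj.ne] at h3
    have : ((2 : Fin 3) : ℕ) = 2 := rfl
    simp only [Fin.val_zero] at h4
    omega

/-- A second leaf or an adjacent support vertex forces `v` to be two already or provides the
positive neighbour needed to make it two. A further leaf is then free. -/
theorem domNumber_addLeaf_le (hG : NoIsolated G) (hadj : G.Adj v h) (hl : IsLeaf G h)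
    (hy : G.Adj v y) (hyh : y ≠ h) (hyl : IsLeaf G y ∨ IsSupport G y) :
    domNumber R (addLeaf G v) ≤ domNumber R G := by
  obtain ⟨g, hg, hw⟩ := exists_dominates_weight_eq R hG
  have key : ∃ g', Dominates R G g' ∧ (g' v : ℕ) = 2 ∧ weight g' ≤ weight g := by
    rcases hyl with hyl | hyl
    · rcases hg.eq_two_or_of_isLeaf hy hyl with h2 | ⟨-, h0⟩
      · exact ⟨g, hg, h2, le_rfl⟩
      · exact hg.exists_eq_two hadj hl hy hyh h0
    · exact hg.exists_eq_two hadj hl hy hyh (hg.pos_of_isSupport hyl)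
  obtain ⟨g', hg', h2, hw'⟩ := key
  have := domNumber_le (hg'.addLeaf_zero h2)
  rw [weight_addLeaf_elim] at this
  simp only [Fin.val_zero] at this
  omega

theorem domNumber_addLeaf_le_add_one (hG : NoIsolated G) (hv : IsSupport G v) :
    domNumber R (addLeaf G v) ≤ domNumber R G + 1 := by
  obtain ⟨g, hg, hw⟩ := exists_dominates_weight_eq R hG
  have hpos := hg.pos_of_isSupport hv
  have : Dominates R (addLeaf G v) (Sum.elim g fun _ => 1) := by
    rintro (a | a)
    · exact DomAt.joinAt_inl (by simpa using hg a)
    · exact domAt_of_pos (w := .inl v) (by simp) (by simp) (by simpa using hpos)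
  have := domNumber_le this
  rw [weight_addLeaf_elim] at this
  simp only [Fin.val_one] at this
  omega

/-- If the new leaf were free, restriction would give a minimum TR2DF of `G` with label two on `v`,
against `S_1`. So the leaf costs exactly one in both numbers. -/
theorem domNumber_eq_addLeaf_of_mem_supportOne (hG : NoIsolated G)
    (he : domNumber False G = domNumber True G) (hv : v ∈ supportOne G) :
    domNumber False (addLeaf G v) = domNumber True (addLeaf G v) := by
  obtain ⟨hs, h1⟩ := mem_supportOne_iff.1 hv
  have h2 := domNumber_addLeaf_le_add_one (R := True) hG hs
  have h4 := domNumber_mono (G := addLeaf G v) hG.joinAt_bot (False.elim : False → True)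
  have h3 : domNumber False G + 1 ≤ domNumber False (addLeaf G v) := by
    refine le_domNumber hG.joinAt_bot fun f hf => ?_
    obtain ⟨h, hadj, hl⟩ := hs
    obtain ⟨f', hf', h2, hw⟩ := hf.addLeaf_restrict hadj hl
    have := domNumber_le hf'
    by_contra hlt
    have := h1 f' hf' (by omega)
    omega
  omega

end AddLeaf

/-! ### Adding two leaves at a leaf (`F5`) -/

section AddTwoLeaves

variable {V : Type*} [Fintype V] {G : SimpleGraph V} {v u : V} {R : Prop}

/-- The graph obtained from `G` by adding two new leaves at `v`. -/
abbrev addTwoLeaves (G : SimpleGraph V) (v : V) : SimpleGraph ((V ⊕ Unit) ⊕ Unit) :=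
  addLeaf (addLeaf G v) (.inl v)

/-- Together `v` and its new leaves weigh at least two, and at least three if `u` is zero, as `v`
then needs a positive new leaf. One unit stays on `v`, one goes to `u` if `u` is zero, and one is
saved. -/
theorem Dominates.addTwoLeaves_restrict (hl : IsLeaf G v) (hu : G.Adj v u)
    {f : (V ⊕ Unit) ⊕ Unit → Fin 3} (hf : Dominates R (addTwoLeaves G v) f) :
    ∃ f', Dominates R G f' ∧ (f' v : ℕ) = 1 ∧ weight f' + 1 ≤ weight f := by
  classical
  have hvu : v ≠ u := hu.ne
  have h1 := hf.eq_two_or_of_isLeaf (v := .inl (.inl v)) (w := .inr ()) (by simp) isLeaf_addLeaf_inr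
  have h2 := hf.eq_two_or_of_isLeaf (v := .inl (.inl v)) (w := .inl (.inr ())) (by simp)
    (isLeaf_of_forall (w := .inl (.inl v)) (by simp) (by rintro ((a | a) | a) <;> simp))
  have h3 := (hf (.inl (.inl v))).1
  rw [nbrWeight_joinAt_inl_self, nbrWeight_joinAt_inl_self, hl.nbrWeight_eq hu] at h3
  obtain ⟨c, hc⟩ : ∃ c : Fin 3, ((c : ℕ) = 1 ∧ (f (.inl (.inl u)) : ℕ) = 0) ∨
      ((c : ℕ) = f (.inl (.inl u)) ∧ 0 < (f (.inl (.inl u)) : ℕ)) := by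
    by_cases h0 : (f (.inl (.inl u)) : ℕ) = 0
    · exact ⟨1, .inl ⟨rfl, h0⟩⟩
    · exact ⟨_, .inr ⟨rfl, by omega⟩⟩
  refine ⟨Function.update (Function.update (f ∘ Sum.inl ∘ Sum.inl) u c) v 1, fun a => ?_, by simp, ?_⟩
  · by_cases hav : a = v
    · subst hav
      exact domAt_of_pos (by simp) hu (by simp [hvu.symm]; omega)
    · by_cases hau : a = u
      · subst hau
        exact domAt_of_pos (by simp [hvu.symm]; omega) hu.symm (by simp)
      · have := hf (.inl (.inl a))
        rw [domAt_joinAt_inl_of_ne (by simpa using hav), domAt_joinAt_inl_of_ne hav] at this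
        refine this.of_le (fun z hz => ?_) (by simp [hav, hau])
        have hzv : z ≠ v := by
          rintro rfl
          exact hau (hl.eq_of_adj hz.symm hu)
        by_cases hzu : z = u
        · subst hzu
          simp [hzv]
          omega
        · simp [hzv, hzu]
  · have h4 := weight_update (Function.update (f ∘ Sum.inl ∘ Sum.inl) u c) v 1
    have h5 := weight_update (f ∘ Sum.inl ∘ Sum.inl) u c
    rw [Function.update_of_ne hvu] at h4
    have h6 := weight_sum f
    have h7 := weight_sum (f ∘ Sum.inl)
    rw [weight_unit] at h6 h7
    simp only [Function.comp, Fin.val_one] at h3 h4 h5 h6 h7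
    change (_ : ℕ) + f (.inl (.inl u)) = _ at h5
    have e1 : weight (fun x => f (.inl (.inl x))) = weight ((f ∘ Sum.inl) ∘ Sum.inl) := rfl
    have e2 : weight (fun x => f (.inl x)) = weight (f ∘ Sum.inl) := rfl
    simp only [Function.comp_def] at *
    omega

theorem domNumber_addTwoLeaves_le {g : V → Fin 3} (hg : Dominates R G g) (h0 : 0 < (g v : ℕ)) :
    domNumber R (addTwoLeaves G v) ≤ weight g + 1 := by
  classical
  have h1 : Dominates R G (Function.update g v 2) := by
    intro a
    refine (hg a).of_le (fun z _ => ?_) ?_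
    · by_cases hz : z = v
      · subst hz
        simpa using fin_three_le_two _
      · simp [hz]
    · by_cases ha : a = v
      · subst ha
        simp
      · simp [ha]
  have hg' : Dominates R (addLeaf G v) (Sum.elim (Function.update g v 2) fun _ => 0) :=
    h1.addLeaf_zero (congrArg Fin.val (Function.update_self v 2 g))
  have hd : Dominates R (addTwoLeaves G v)
      (Sum.elim (Sum.elim (Function.update g v 2) fun _ => 0) fun _ => 0) :=
    hg'.addLeaf_zero (congrArg Fin.val (Function.update_self v 2 g))
  have h2 := domNumber_le hd
  rw [weight_addLeaf_elim, weight_addLeaf_elim, Fin.val_zero, add_zero, add_zero] at h2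
  have h3 : _ = weight g + 2 := weight_update g v 2
  exact h2.trans (by omega)

theorem domNumber_add_one_le_addTwoLeaves (hG : NoIsolated G) (hl : IsLeaf G v) :
    domNumber R G + 1 ≤ domNumber R (addTwoLeaves G v) := by
  obtain ⟨u, hu⟩ := hG v
  refine le_domNumber hG.joinAt_bot.joinAt_bot fun f hf => ?_
  obtain ⟨f', hf', -, hw⟩ := hf.addTwoLeaves_restrict hl hu
  have := domNumber_le hf'
  omega

theorem domNumber_eq_addTwoLeaves_of_mem_leafTR1 (hG : NoIsolated G)
    (he : domNumber False G = domNumber True G) (hv : v ∈ leafTR1 G) :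
    domNumber False (addTwoLeaves G v) = domNumber True (addTwoLeaves G v) := by
  obtain ⟨hl, f, hf, hw, h1⟩ := mem_leafTR1_iff.1 hv
  have h2 := domNumber_add_one_le_addTwoLeaves (R := False) hG hl
  have h3 := domNumber_addTwoLeaves_le (v := v) hf (by omega)
  have h4 := domNumber_mono (G := addTwoLeaves G v) hG.joinAt_bot.joinAt_bot (False.elim : False → True)
  omega

theorem mem_leafTR1_of_addTwoLeaves (hG : NoIsolated G) (hl : IsLeaf G v)
    (hle : domNumber False (addTwoLeaves G v) ≤ domNumber False G + 1)
    (he : domNumber False (addTwoLeaves G v) = domNumber True (addTwoLeaves G v)) :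
    domNumber False G = domNumber True G ∧ v ∈ leafTR1 G := by
  have h1 := domNumber_add_one_le_addTwoLeaves (R := True) hG hl
  have h2 := domNumber_mono hG (False.elim : False → True)
  refine ⟨by omega, mem_leafTR1_iff.2 ⟨hl, ?_⟩⟩
  obtain ⟨u, hu⟩ := hG v
  obtain ⟨f, hf, hw⟩ := exists_dominates_weight_eq True
    (show NoIsolated (addTwoLeaves G v) from hG.joinAt_bot.joinAt_bot)
  obtain ⟨f', hf', h1, hw'⟩ := hf.addTwoLeaves_restrict hl hu
  have := domNumber_le hf'
  exact ⟨f', hf', by omega, h1⟩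

end AddTwoLeaves

/-! ### Paths of order two and three -/

theorem path_two_adj_zero (x : Fin 2) : (pathGraph 2).Adj 0 x ↔ x = 1 := by
  fin_cases x <;> simp [pathGraph_adj]

theorem path_two_adj_one (x : Fin 2) : (pathGraph 2).Adj 1 x ↔ x = 0 := by
  fin_cases x <;> simp [pathGraph_adj]

theorem path_three_adj_zero (x : Fin 3) : (pathGraph 3).Adj 0 x ↔ x = 1 := by
  fin_cases x <;> simp [pathGraph_adj]

theorem path_three_adj_one (x : Fin 3) : (pathGraph 3).Adj 1 x ↔ x = 0 ∨ x = 2 := by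
  fin_cases x <;> simp [pathGraph_adj]

theorem path_three_adj_two (x : Fin 3) : (pathGraph 3).Adj 2 x ↔ x = 1 := by
  fin_cases x <;> simp [pathGraph_adj]

theorem noIsolated_path_two : NoIsolated (pathGraph 2) := by
  intro v
  fin_cases v
  · exact ⟨1, (path_two_adj_zero 1).2 rfl⟩
  · exact ⟨0, (path_two_adj_one 0).2 rfl⟩

theorem noIsolated_path_three : NoIsolated (pathGraph 3) := by
  intro v
  fin_cases v
  · exact ⟨1, (path_three_adj_zero 1).2 rfl⟩
  · exact ⟨0, (path_three_adj_one 0).2 (.inl rfl)⟩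
  · exact ⟨1, (path_three_adj_two 1).2 rfl⟩

theorem nbrWeight_path_three_one (f : Fin 3 → Fin 3) :
    nbrWeight (pathGraph 3) f 1 = f 0 + f 2 := by
  classical
  rw [nbrWeight, ← Finset.sum_pair (f := fun x => (f x : ℕ)) (show (0 : Fin 3) ≠ 2 by decide)]
  refine Finset.sum_congr ?_ fun _ _ => rfl
  ext x
  simp [path_three_adj_one]

/-! ### Moving weight across the joining edge -/

section Transfer

variable {V W : Type*} [Fintype V] [Fintype W] {G : SimpleGraph V} {H : SimpleGraph W} {v w : V}
  {x : W} {R : Prop}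

theorem isLeaf_joinAt_inl {h : V} (hl : IsLeaf G h) (hv : h ≠ v) :
    IsLeaf (joinAt G H v x) (.inl h) := by
  obtain ⟨s, hs⟩ := isLeaf_iff.1 hl
  refine isLeaf_iff.2 ⟨.inl s, ?_⟩
  rintro (a | a)
  · simp [hs]
  · simp [hv]

theorem isLeaf_joinAt_inr {h : W} (hl : IsLeaf H h) (hv : h ≠ x) :
    IsLeaf (joinAt G H v x) (.inr h) := by
  obtain ⟨s, hs⟩ := isLeaf_iff.1 hl
  refine isLeaf_iff.2 ⟨.inr s, ?_⟩
  rintro (a | a)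
  · simp [hv]
  · simp [hs]

/-- A label on the attached part that is seen by `v` can be moved into `G`. -/
theorem Dominates.exists_transfer (hG : NoIsolated G) {f : V ⊕ W → Fin 3}
    (hf : Dominates R (joinAt G H v x) f) :
    ∃ f', Dominates R G f' ∧ weight f' ≤ weight (f ∘ Sum.inl) + f (.inr x) ∧
      (0 < (f (.inr x) : ℕ) → 0 < (f' v : ℕ)) := by
  classical
  have hother : ∀ a, a ≠ v → DomAt R G (f ∘ Sum.inl) a := fun a ha =>
    (domAt_joinAt_inl_of_ne ha).1 (hf (.inl a))
  have hv := hf (.inl v)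
  rw [domAt_joinAt_inl_self] at hv
  have ht2 := fin_three_le_two (f (.inr x))
  obtain ⟨y, hy⟩ := hG v
  obtain ⟨t, ht⟩ : ∃ t : ℕ, t = f (.inr x) := ⟨_, rfl⟩
  by_cases ht0 : t = 0
  · refine ⟨f ∘ Sum.inl, fun a => ?_, by omega, by omega⟩
    by_cases ha : a = v
    · subst ha
      refine ⟨by omega, fun h0 => ⟨by have := (hv.2 h0).1; omega, fun hR => ?_⟩⟩
      rcases (hv.2 h0).2 hR with h | h
      · exact h
      · omega
    · exact hother a ha
  -- the labels that replace those of `v` and of the chosen neighbour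
  obtain ⟨c, hc⟩ : ∃ c : Fin 3, ((c : ℕ) = 1 ∧ (f (.inl v) : ℕ) = 0) ∨
      ((c : ℕ) = f (.inl v) ∧ 0 < (f (.inl v) : ℕ)) := by
    by_cases h0 : (f (.inl v) : ℕ) = 0
    · exact ⟨1, .inl ⟨rfl, h0⟩⟩
    · exact ⟨_, .inr ⟨rfl, by omega⟩⟩
  -- If `v` is zero and `t = 1`, the unit pays for raising `v`, which still has a positive neighbour
  -- in `G` because its neighbour weight was at least two. Otherwise a unit is available to make `y`
  -- positive: either `v` costs nothing or `t = 2`.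
  obtain ⟨d, hd, hd'⟩ : ∃ d : Fin 3, (f (.inl y) : ℕ) ≤ d ∧
      ((f (.inl v) : ℕ) = 0 ∧ t = 1 ∧ (d : ℕ) = f (.inl y) ∨
        0 < (d : ℕ) ∧ (d : ℕ) ≤ f (.inl y) + 1 ∧ ((f (.inl v) : ℕ) = 0 → t = 2)) := by
    by_cases h0 : (f (.inl v) : ℕ) = 0 ∧ t = 1
    · exact ⟨f (.inl y), le_rfl, .inl ⟨h0.1, h0.2, rfl⟩⟩
    · by_cases h1 : (f (.inl y) : ℕ) = 0
      · exact ⟨1, by omega, .inr ⟨by simp, by simp, by omega⟩⟩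
      · exact ⟨f (.inl y), le_rfl, .inr ⟨by omega, by omega, by omega⟩⟩
  have hvy : v ≠ y := hy.ne
  have hle : ∀ z, (f (.inl z) : ℕ) ≤ Function.update (Function.update (f ∘ Sum.inl) y d) v c z := by
    intro z
    by_cases hzv : z = v
    · subst hzv
      simp only [Function.update_self]
      omega
    · by_cases hzy : z = y
      · subst hzy
        simpa [hzv] using hd
      · simp [hzv, hzy]
  have hcpos : 0 < (c : ℕ) := by omega
  refine ⟨Function.update (Function.update (f ∘ Sum.inl) y d) v c, fun a => ?_, ?_, ?_⟩
  · by_cases ha : a = v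
    · subst ha
      rcases hd' with ⟨h0, h1, -⟩ | ⟨h0, -⟩
      · obtain ⟨z, hz, hz0⟩ := nbrWeight_pos.1
          (show 0 < nbrWeight G (f ∘ Sum.inl) a by have := (hv.2 h0).1; omega)
        exact domAt_of_pos (by simpa using hcpos) hz (hz0.trans_le (hle z))
      · exact domAt_of_pos (by simpa using hcpos) hy (by simpa [hvy.symm] using h0)
    · exact (hother a ha).of_le (fun z _ => hle z) fun h => by
        have := hle a
        simp only [Function.comp] at *
        omega
  · have h1 := weight_update (Function.update (f ∘ Sum.inl) y d) v c
    have h2 := weight_update (f ∘ Sum.inl) y d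
    rw [Function.update_of_ne hvy] at h1
    simp only [Function.comp_apply] at h1 h2
    omega
  · intro
    simpa using hcpos

end Transfer

/-! ### Attaching a path of order two (`F4`, `F6`) -/

section AddPathTwo

variable {V : Type*} [Fintype V] {G : SimpleGraph V} {v w u : V} {R : Prop}

/-- A path of order two is attached to `v` by an end. -/
abbrev addPathTwo (G : SimpleGraph V) (v : V) : SimpleGraph (V ⊕ Fin 2) :=
  joinAt G (pathGraph 2) v 0

/-- At zero vertices the weight bounds already give a positive neighbour. So totality may be asked
everywhere, and only the bound two is waived at `v`. -/
theorem isNearTR2DF_iff {f : V → Fin 3} : IsNearTR2DF G v f ↔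
    ∀ x, 0 < nbrWeight G f x ∧ ((f x : ℕ) = 0 → x ≠ v → 2 ≤ nbrWeight G f x) := by
  simp only [IsNearTR2DF, Fin.ext_iff, ← Fin.val_pos_iff, ← nbrWeight_pos]
  change ((∀ x, (f x : ℕ) = 0 → _) ∧ _) ↔ _
  constructor
  · rintro ⟨h1, h2⟩ x
    refine ⟨?_, fun h0 => (h1 x h0).2⟩
    by_cases h0 : (f x : ℕ) = 0
    · by_cases hx : x = v
      · exact (h1 x h0).1 hx
      · have := (h1 x h0).2 hx
        omega
    · exact h2 x (by omega)
  · intro h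
    exact ⟨fun x h0 => ⟨fun _ => (h x).1, (h x).2 h0⟩, fun x _ => (h x).1⟩

theorem gammaNearTR2_le {f : V → Fin 3} (h : IsNearTR2DF G v f) : gammaNearTR2 G v ≤ weight f :=
  Nat.sInf_le ⟨f, h, rfl⟩

theorem Dominates.isNearTR2DF {f : V → Fin 3} (h : Dominates R G f) : IsNearTR2DF G v f :=
  isNearTR2DF_iff.2 fun x => ⟨(h x).1, fun h0 _ => ((h x).2 h0).1⟩

theorem exists_isNearTR2DF (hG : NoIsolated G) (v : V) :
    ∃ f, IsNearTR2DF G v f ∧ weight f = gammaNearTR2 G v :=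
  Nat.sInf_mem (s := {w | ∃ f : V → Fin 3, IsNearTR2DF G v f ∧ weight f = w})
    ⟨_, _, (dominates_const_one (R := False) hG).isNearTR2DF, rfl⟩

theorem gammaNearTR2_le_domNumber (hG : NoIsolated G) : gammaNearTR2 G v ≤ domNumber False G :=
  le_domNumber hG fun _ hf => gammaNearTR2_le hf.isNearTR2DF

theorem weight_addPathTwo (f : V ⊕ Fin 2 → Fin 3) :
    weight f = weight (f ∘ Sum.inl) + (f (.inr 0) + f (.inr 1)) := by
  rw [weight_sum]
  simp [weight, Fin.sum_univ_two]

theorem Dominates.addPathTwo_facts {f : V ⊕ Fin 2 → Fin 3}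
    (hf : Dominates R (addPathTwo G v) f) :
    0 < (f (.inr 0) : ℕ) ∧ ((f (.inr 1) : ℕ) = 0 → (f (.inr 0) : ℕ) = 2) ∧
      0 < (f (.inr 1) : ℕ) + f (.inl v) := by
  have h0 := (hf (.inr 0)).1
  rw [nbrWeight_joinAt_inr_self, nbrWeight_eq_of_unique path_two_adj_zero] at h0
  have h1 := (domAt_joinAt_inr_of_ne (by simp)).1 (hf (.inr 1))
  rw [DomAt, nbrWeight_eq_of_unique path_two_adj_one] at h1
  have := fin_three_le_two (f (.inr 0))
  simp only [Function.comp_apply] at h0 h1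
  exact ⟨h1.1, fun h => by have := (h1.2 h).1; omega, h0⟩

/-- The end of the path next to `v`, labelled one, supplies the unit that `v` may be missing. -/
theorem IsNearTR2DF.addPathTwo_one {g : V → Fin 3} (hg : IsNearTR2DF G v g) :
    Dominates False (addPathTwo G v) (Sum.elim g fun _ => 1) := by
  rw [isNearTR2DF_iff] at hg
  rintro (a | a)
  · by_cases ha : a = v
    · subst ha
      have := (hg a).1
      refine ⟨?_, fun _ => ⟨?_, False.elim⟩⟩ <;> rw [nbrWeight_joinAt_inl_self] <;>
        simp only [Sum.elim_comp_inl, Sum.elim_inr, Fin.val_one] <;> omega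
    · rw [domAt_joinAt_inl_of_ne ha]
      exact ⟨by simpa using (hg a).1, fun h0 => ⟨by simpa using (hg a).2 h0 ha, False.elim⟩⟩
  · obtain ⟨b, hb⟩ := noIsolated_path_two a
    exact domAt_of_pos (w := .inr b) (by simp) (by simpa using hb) (by simp)

theorem Dominates.addPathTwo_one {g : V → Fin 3} (hg : Dominates R G g) :
    Dominates R (addPathTwo G v) (Sum.elim g fun _ => 1) := by
  rintro (a | a)
  · exact DomAt.joinAt_inl (by simpa using hg a)
  · obtain ⟨b, hb⟩ := noIsolated_path_two a
    exact domAt_of_pos (w := .inr b) (by simp) (by simpa using hb) (by simp)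

theorem weight_addPathTwo_elim (g : V → Fin 3) :
    weight (Sum.elim g fun _ : Fin 2 => (1 : Fin 3)) = weight g + 2 := by
  rw [weight_addPathTwo]
  rfl

theorem domNumber_addPathTwo_le (hG : NoIsolated G) :
    domNumber R (addPathTwo G v) ≤ domNumber R G + 2 := by
  obtain ⟨g, hg, hw⟩ := exists_dominates_weight_eq R hG
  rw [← hw, ← weight_addPathTwo_elim]
  exact domNumber_le hg.addPathTwo_one

theorem domNumber_addPathTwo_le_near (hG : NoIsolated G) :
    domNumber False (addPathTwo G v) ≤ gammaNearTR2 G v + 2 := by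
  obtain ⟨g, hg, hw⟩ := exists_isNearTR2DF hG v
  rw [← hw, ← weight_addPathTwo_elim]
  exact domNumber_le hg.addPathTwo_one

/-- Suppose `v` is zero. If the path end next to it is two, the far end is positive, so the path
weighs at least three and a unit is left for `v`. If that end is one, it is no help to `v` in the
Roman sense; in the {2}-sense `v` may be left with neighbour weight one, whence the near variant. -/
theorem Dominates.addPathTwo_restrict {f : V ⊕ Fin 2 → Fin 3}
    (hf : Dominates R (addPathTwo G v) f) (hw : G.Adj v w) (hpos : 0 < (f (.inl w) : ℕ)) :
    ∃ f', (∀ a, a ≠ v → DomAt R G f' a) ∧ 0 < nbrWeight G f' v ∧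
      (R ∨ 0 < (f (.inl v) : ℕ) → DomAt R G f' v) ∧ weight f' + 2 ≤ weight f := by
  classical
  obtain ⟨h1, h2, h3⟩ := hf.addPathTwo_facts
  have hv := hf (.inl v)
  rw [domAt_joinAt_inl_self] at hv
  have h4 := fin_three_le_two (f (.inr 0))
  obtain ⟨c, hc⟩ : ∃ c : Fin 3, ((c : ℕ) = 1 ∧ (f (.inl v) : ℕ) = 0 ∧ (f (.inr 0) : ℕ) = 2) ∨
      ((c : ℕ) = f (.inl v) ∧ ((f (.inl v) : ℕ) = 0 → (f (.inr 0) : ℕ) = 1)) := by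
    by_cases h0 : (f (.inl v) : ℕ) = 0 ∧ (f (.inr 0) : ℕ) = 2
    · exact ⟨1, .inl ⟨rfl, h0⟩⟩
    · exact ⟨_, .inr ⟨rfl, by omega⟩⟩
  have hle : ∀ z, (f (.inl z) : ℕ) ≤ Function.update (f ∘ Sum.inl) v c z := by
    intro z
    by_cases hzv : z = v
    · subst hzv
      simp only [Function.update_self]
      omega
    · simp [hzv]
  have hnv : 0 < nbrWeight G (Function.update (f ∘ Sum.inl) v c) v :=
    nbrWeight_pos.2 ⟨w, hw, hpos.trans_le (hle w)⟩
  refine ⟨Function.update (f ∘ Sum.inl) v c, fun a ha => ?_, hnv, fun hR => ?_, ?_⟩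
  · exact ((domAt_joinAt_inl_of_ne ha).1 (hf (.inl a))).of_le (fun z _ => hle z)
      (by simp [ha])
  · refine ⟨hnv, fun h0 => ?_⟩
    simp only [Function.update_self] at h0
    have hR' : R := hR.resolve_right (by omega)
    obtain ⟨z, hz, hz2⟩ := ((hv.2 (by omega)).2 hR').resolve_right (by omega)
    have hz3 := hle z
    have hz4 : (Function.update (f ∘ Sum.inl) v c z : ℕ) = 2 :=
      le_antisymm (fin_three_le_two _) (by omega)
    exact ⟨hz4.ge.trans (le_nbrWeight hz), fun _ => ⟨z, hz, hz4⟩⟩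
  · have h5 := weight_update (f ∘ Sum.inl) v c
    rw [weight_addPathTwo f]
    simp only [Function.comp_apply] at h5
    omega

theorem Dominates.pos_of_isLeaf_of_ne {W : Type*} [Fintype W] {H : SimpleGraph W} {x : W} {h : V}
    {f : V ⊕ W → Fin 3} (hf : Dominates R (joinAt G H v x) f) (hadj : G.Adj w h)
    (hl : IsLeaf G h) (hv : h ≠ v) : 0 < (f (.inl w) : ℕ) :=
  hf.pos_of_isSupport ⟨.inl h, by simpa using hadj, isLeaf_joinAt_inl hl hv⟩

theorem domNumber_True_add_two_le_addPathTwo (hG : NoIsolated G) {h : V} (hw : G.Adj v w)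
    (hadj : G.Adj w h) (hl : IsLeaf G h) (hv : h ≠ v) :
    domNumber True G + 2 ≤ domNumber True (addPathTwo G v) := by
  refine le_domNumber (hG.joinAt noIsolated_path_two) fun f hf => ?_
  obtain ⟨f', h1, -, h2, h3⟩ := hf.addPathTwo_restrict hw (hf.pos_of_isLeaf_of_ne hadj hl hv)
  have := domNumber_le (G := G) (R := True) (f := f') fun a => by
    by_cases ha : a = v
    · exact ha ▸ h2 (.inl trivial)
    · exact h1 a ha
  omega

/-- After subtracting two, the number of the larger graph is at least `domNumber True G` and at most
`gammaNearTR2 G v ≤ domNumber False G ≤ domNumber True G`, so all of these agree. -/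
theorem isNearStable_of_addPathTwo (hG : NoIsolated G)
    (hle : domNumber True G + 2 ≤ domNumber True (addPathTwo G v))
    (he : domNumber False (addPathTwo G v) = domNumber True (addPathTwo G v)) :
    domNumber False G = domNumber True G ∧ IsNearStable G v := by
  have h1 := domNumber_addPathTwo_le (R := False) (v := v) hG
  have h2 := domNumber_addPathTwo_le_near (v := v) hG
  have h3 := gammaNearTR2_le_domNumber (v := v) hG
  have h4 := domNumber_mono hG (False.elim : False → True)
  rw [IsNearStable, gammaTR2_eq]
  omega

/-- Their leaves keep `v` and its support neighbour `w` positive, so the path can be cut off. The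
exception is that `v` is itself the leaf of `w`; then `v` has label two and `w` zero, and both are
relabelled one. -/
theorem domNumber_False_add_two_le_of_mem_supportAdj (hG : NoIsolated G) (hv : v ∈ supportAdj G) :
    domNumber False G + 2 ≤ domNumber False (addPathTwo G v) := by
  classical
  obtain ⟨⟨h', hadj', hl'⟩, w, hw, h, hadj, hl⟩ := hv
  refine le_domNumber (hG.joinAt noIsolated_path_two) fun f hf => ?_
  have hfv : 0 < (f (.inl v) : ℕ) := hf.pos_of_isLeaf_of_ne hadj' hl' hadj'.ne'
  have key : ∃ f', Dominates False G f' ∧ weight f' + 2 ≤ weight f := by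
    by_cases hpos : 0 < (f (.inl w) : ℕ)
    · obtain ⟨f', h1, -, h2, h3⟩ := hf.addPathTwo_restrict hw hpos
      refine ⟨f', fun a => ?_, h3⟩
      by_cases ha : a = v
      · exact ha ▸ h2 (.inr hfv)
      · exact h1 a ha
    · -- then `v` and `w` form a component
      have hhv : h = v := by
        by_contra hne
        exact hpos (hf.pos_of_isLeaf_of_ne hadj hl hne)
      subst hhv
      have hw' : h' = w := hl.eq_of_adj hadj' hw
      subst hw'
      obtain ⟨g1, g2, g3⟩ := hf.addPathTwo_facts
      have h2 := hf.eq_two_or_of_isLeaf (v := .inl h) (w := .inl h') (by simpa using hw)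
        (isLeaf_joinAt_inl hl' hadj'.ne')
      refine ⟨Function.update (Function.update (f ∘ Sum.inl) h' 1) h 1, fun a => ?_, ?_⟩
      · by_cases ha : a = h
        · subst ha
          exact domAt_of_pos (by simp) hw (by simp [hw.ne'])
        · by_cases ha' : a = h'
          · subst ha'
            exact domAt_of_pos (by simp [hw.ne']) hw.symm (by simp)
          · refine ((domAt_joinAt_inl_of_ne ha).1 (hf (.inl a))).of_le (fun z hz => ?_)
              (by simp [ha, ha'])
            have hzh : z ≠ h := by
              rintro rfl
              exact ha' (hl.eq_of_adj hz.symm hw)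
            have hzh' : z ≠ h' := by
              rintro rfl
              exact ha (hl'.eq_of_adj hz.symm hw.symm)
            simp [hzh, hzh']
      · have h5 := weight_update (Function.update (f ∘ Sum.inl) h' 1) h 1
        have h6 := weight_update (f ∘ Sum.inl) h' 1
        rw [Function.update_of_ne hw.ne] at h5
        rw [weight_addPathTwo f]
        simp only [Function.comp_apply, Fin.val_one] at h5 h6
        omega
  obtain ⟨f', hf', hw'⟩ := key
  have := domNumber_le hf'
  omega

theorem exists_adj_ne_pos {f : V → Fin 3} (h : (f v : ℕ) < nbrWeight G f u) :
    ∃ y, y ≠ v ∧ G.Adj u y ∧ 0 < (f y : ℕ) := by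
  classical
  by_contra! hcon
  refine absurd h (not_lt.2 ?_)
  rw [nbrWeight]
  calc ∑ x with G.Adj u x, (f x : ℕ) ≤ ∑ x ∈ {v}, (f x : ℕ) := by
        refine Finset.sum_le_sum_of_ne_zero fun x hx hx0 => ?_
        by_contra hxv
        have := hcon x (by simpa using hxv) (by simpa using hx)
        omega
    _ = f v := by simp

/-- Since `v` is not a leaf, the leaf at the adjacent support vertex survives the attachment and
keeps that support vertex positive. -/
theorem gammaNearTR2_add_two_le_of_isSemiSupport (hG : NoIsolated G) (hv : IsSemiSupport G v) :
    gammaNearTR2 G v + 2 ≤ domNumber False (addPathTwo G v) := by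
  obtain ⟨hnl, s, hs, h, hadj, hl⟩ := hv
  have hhv : h ≠ v := by
    rintro rfl
    exact hnl hl
  refine le_domNumber (hG.joinAt noIsolated_path_two) fun f hf => ?_
  obtain ⟨f', h1, h2, -, h3⟩ := hf.addPathTwo_restrict hs (hf.pos_of_isLeaf_of_ne hadj hl hhv)
  have := gammaNearTR2_le (G := G) (v := v) (f := f') <| isNearTR2DF_iff.2 fun a => by
    by_cases ha : a = v
    · subst ha
      exact ⟨h2, fun _ h => absurd rfl h⟩
    · exact ⟨(h1 a ha).1, fun h0 _ => ((h1 a ha).2 h0).1⟩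
  omega

/-- If the neighbour `u` of `v` is zero it is raised to one. The unit comes from `v`, or from the
path when `v` is zero, because the path then weighs at least three. -/
theorem gammaNearTR2_add_two_le_of_isLeaf (hG : NoIsolated G) (hv : IsLeaf G v) :
    gammaNearTR2 G v + 2 ≤ domNumber False (addPathTwo G v) := by
  classical
  obtain ⟨u, hu⟩ := hG v
  refine le_domNumber (hG.joinAt noIsolated_path_two) fun f hf => ?_
  obtain ⟨h1, h2, h3⟩ := hf.addPathTwo_facts
  have hfw := weight_addPathTwo f
  have hother : ∀ a, a ≠ v → DomAt False G (f ∘ Sum.inl) a := fun a ha =>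
    (domAt_joinAt_inl_of_ne ha).1 (hf (.inl a))
  have hfv := hf (.inl v)
  rw [domAt_joinAt_inl_self, hv.nbrWeight_eq hu] at hfv
  have huv : u ≠ v := hu.ne'
  have hfu := hother u huv
  have ha2 := fin_three_le_two (f (.inr 0))
  have key : ∃ f', (∀ x, 0 < nbrWeight G f' x ∧ ((f' x : ℕ) = 0 → x ≠ v → 2 ≤ nbrWeight G f' x)) ∧
      weight f' + 2 ≤ weight f := by
    by_cases hpu : 0 < (f (.inl u) : ℕ)
    · refine ⟨f ∘ Sum.inl, fun x => ?_, by omega⟩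
      by_cases hx : x = v
      · subst hx
        exact ⟨by rw [hv.nbrWeight_eq hu]; exact hpu, fun _ h => absurd rfl h⟩
      · exact ⟨(hother x hx).1, fun h0 _ => ((hother x hx).2 h0).1⟩
    have hu0 : (f (.inl u) : ℕ) = 0 := by omega
    have hnu := (hfu.2 hu0).1
    -- The subtraction is truncated: a zero label of `v` stays zero.
    obtain ⟨c, hc⟩ : ∃ c : Fin 3, (c : ℕ) = (f (.inl v) : ℕ) - 1 :=
      ⟨⟨(f (.inl v) : ℕ) - 1, by omega⟩, rfl⟩
    refine ⟨Function.update (Function.update (f ∘ Sum.inl) u 1) v c, fun x => ?_, ?_⟩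
    · by_cases hx : x = v
      · subst hx
        exact ⟨by rw [hv.nbrWeight_eq hu]; simp [huv], fun _ h => absurd rfl h⟩
      · by_cases hxu : x = u
        · subst hxu
          refine ⟨?_, by simp [huv]⟩
          -- From label two, `v` keeps one and serves `u`. From a smaller label, `v` did not supply
          -- all of the neighbour weight of `u`, which was at least two.
          by_cases h2v : (f (.inl v) : ℕ) = 2
          · exact nbrWeight_pos.2 ⟨v, hu.symm, by simp; omega⟩
          · have := fin_three_le_two (f (.inl v))
            obtain ⟨y, hyv, hy, hy0⟩ := exists_adj_ne_pos (f := f ∘ Sum.inl) (v := v)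
              (u := x) (G := G) (by simp only [Function.comp_apply]; omega)
            exact nbrWeight_pos.2 ⟨y, hy, by simpa [hyv, hy.ne'] using hy0⟩
        · have hd : DomAt False G (Function.update (Function.update (f ∘ Sum.inl) u 1) v c) x := by
            refine (hother x hx).of_le (fun z hz => ?_) (by simp [hx, hxu])
            have hzv : z ≠ v := by
              rintro rfl
              exact hxu (hv.eq_of_adj hz.symm hu)
            by_cases hzu : z = u
            · subst hzu
              simp [hzv, hu0]
            · simp [hzv, hzu]
          exact ⟨hd.1, fun h0 _ => (hd.2 h0).1⟩
    · have h5 := weight_update (Function.update (f ∘ Sum.inl) u 1) v c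
      have h6 := weight_update (f ∘ Sum.inl) u 1
      rw [Function.update_of_ne hu.ne] at h5
      simp only [Function.comp_apply, Fin.val_one] at h5 h6
      have h7 : (f (.inl v) : ℕ) = 0 → (f (.inr 0) : ℕ) = 2 := fun h0 => by
        have := (hfv.2 h0).1
        simp only [Function.comp_apply] at this
        omega
      omega
  obtain ⟨f', hf', hw'⟩ := key
  have := gammaNearTR2_le (isNearTR2DF_iff.2 hf')
  omega

theorem domNumber_eq_addPathTwo (hG : NoIsolated G) (he : domNumber False G = domNumber True G)
    (hle : domNumber False G + 2 ≤ domNumber False (addPathTwo G v)) :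
    domNumber False (addPathTwo G v) = domNumber True (addPathTwo G v) := by
  have h1 := domNumber_addPathTwo_le (R := True) (v := v) hG
  have h4 := domNumber_mono (G := addPathTwo G v) (hG.joinAt noIsolated_path_two)
    (False.elim : False → True)
  omega

theorem domNumber_eq_addPathTwo_of_isNearStable (hG : NoIsolated G)
    (he : domNumber False G = domNumber True G) (hs : IsNearStable G v)
    (hv : IsLeaf G v ∨ IsSemiSupport G v) :
    domNumber False (addPathTwo G v) = domNumber True (addPathTwo G v) := by
  refine domNumber_eq_addPathTwo hG he ?_
  rw [IsNearStable, gammaTR2_eq] at hs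
  rw [← hs]
  exact hv.elim (gammaNearTR2_add_two_le_of_isLeaf hG) (gammaNearTR2_add_two_le_of_isSemiSupport hG)

end AddPathTwo

/-! ### Attaching a path of order three (`F7`) -/

section AddPathThree

variable {V : Type*} [Fintype V] {G : SimpleGraph V} {v w u : V} {R : Prop}

/-- A path of order three is attached to `v` by an end. -/
abbrev addPathThree (G : SimpleGraph V) (v : V) : SimpleGraph (V ⊕ Fin 3) :=
  joinAt G (pathGraph 3) v 0

theorem weight_addPathThree (f : V ⊕ Fin 3 → Fin 3) :
    weight f = weight (f ∘ Sum.inl) + (f (.inr 0) + f (.inr 1) + f (.inr 2)) := by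
  rw [weight_sum]
  simp [weight, Fin.sum_univ_three]

theorem Dominates.addPathThree_facts {f : V ⊕ Fin 3 → Fin 3}
    (hf : Dominates R (addPathThree G v) f) :
    0 < (f (.inr 1) : ℕ) ∧ ((f (.inr 2) : ℕ) = 0 → (f (.inr 1) : ℕ) = 2) ∧
      0 < (f (.inr 0) : ℕ) + f (.inr 2) ∧
      ((f (.inr 0) : ℕ) = 0 → 2 ≤ (f (.inr 1) : ℕ) + f (.inl v) ∧
        (R → (f (.inr 1) : ℕ) = 2 ∨ (f (.inl v) : ℕ) = 2)) := by
  have h0 := hf (.inr 0)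
  rw [domAt_joinAt_inr_self, nbrWeight_eq_of_unique path_three_adj_zero] at h0
  have h1 := (domAt_joinAt_inr_of_ne (by simp)).1 (hf (.inr 1))
  rw [DomAt, nbrWeight_path_three_one] at h1
  have h2 := (domAt_joinAt_inr_of_ne (by simp)).1 (hf (.inr 2))
  rw [DomAt, nbrWeight_eq_of_unique path_three_adj_two] at h2
  have := fin_three_le_two (f (.inr 1))
  simp only [Function.comp_apply] at h0 h1 h2
  refine ⟨h2.1, fun h => by have := (h2.2 h).1; omega, h1.1, fun h => ⟨(h0.2 h).1, fun hR => ?_⟩⟩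
  simpa [path_three_adj_zero] using (h0.2 h).2 hR

theorem Dominates.addPathThree_zero_two_one {g : V → Fin 3} (hg : Dominates R G g) :
    Dominates R (addPathThree G v) (Sum.elim g ![0, 2, 1]) := by
  rintro (a | a)
  · exact DomAt.joinAt_inl (by simpa using hg a)
  · fin_cases a
    · exact domAt_of_two (w := .inr 1) (by simp [path_three_adj_zero]) (by simp)
    · exact domAt_of_pos (w := .inr 2) (by simp) (by simp [path_three_adj_one]) (by simp)
    · exact domAt_of_two (w := .inr 1) (by simp [path_three_adj_two]) (by simp)

theorem domNumber_addPathThree_le (hG : NoIsolated G) :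
    domNumber R (addPathThree G v) ≤ domNumber R G + 3 := by
  obtain ⟨g, hg, hw⟩ := exists_dominates_weight_eq R hG
  rw [← hw]
  refine (domNumber_le hg.addPathThree_zero_two_one).trans ?_
  rw [weight_addPathThree]
  simp

/-- A positive `v` and the middle vertex of the path together give its first vertex weight two,
which saves a unit against `![0, 2, 1]`. -/
theorem Dominates.addPathThree_zero_one_one {g : V → Fin 3} (hg : Dominates False G g)
    (hv : 0 < (g v : ℕ)) : Dominates False (addPathThree G v) (Sum.elim g ![0, 1, 1]) := by
  rintro (a | a)
  · exact DomAt.joinAt_inl (by simpa using hg a)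
  · fin_cases a
    · refine (domAt_joinAt_inr_self (R := False) (x := (0 : Fin 3))).2 ?_
      rw [nbrWeight_eq_of_unique path_three_adj_zero]
      refine ⟨by simp, fun _ => ⟨?_, False.elim⟩⟩
      simp
      omega
    · exact domAt_of_pos (w := .inr 2) (by simp) (by simp [path_three_adj_one]) (by simp)
    · exact domAt_of_pos (w := .inr 1) (by simp) (by simp [path_three_adj_two]) (by simp)

theorem dominates_comp_inl {W : Type*} [Fintype W] {H : SimpleGraph W} {x : W} {f : V ⊕ W → Fin 3}
    (hf : Dominates R (joinAt G H v x) f) (hx : (f (.inr x) : ℕ) = 0) :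
    Dominates R G (f ∘ Sum.inl) := by
  intro a
  by_cases ha : a = v
  · subst ha
    have := hf (.inl a)
    rw [domAt_joinAt_inl_self] at this
    refine ⟨by omega, fun h0 => ⟨by have := (this.2 h0).1; omega, fun hR => ?_⟩⟩
    exact ((this.2 h0).2 hR).resolve_right (by omega)
  · exact (domAt_joinAt_inl_of_ne ha).1 (hf (.inl a))

/-- The last two path vertices weigh at least two. Either they weigh three, or a positive label on
`v` or on the first path vertex yields a dominating function of `G` that is positive at `v`, hence
not minimum. -/
theorem domNumber_add_three_le_of_mem_zeroSet (hG : NoIsolated G) (hv : v ∈ zeroSet G) :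
    domNumber False G + 3 ≤ domNumber False (addPathThree G v) := by
  rw [mem_zeroSet_iff] at hv
  refine le_domNumber (hG.joinAt noIsolated_path_three) fun f hf => ?_
  obtain ⟨h1, h2, h3, h4⟩ := hf.addPathThree_facts
  have hw := weight_addPathThree f
  have key : ∀ f', Dominates False G f' → 0 < (f' v : ℕ) → domNumber False G + 1 ≤ weight f' := by
    intro f' hf' h0
    have h5 := domNumber_le hf'
    by_contra hlt
    have := hv f' hf' (by omega)
    omega
  by_cases ha : (f (.inr 0) : ℕ) = 0
  · have hf' := dominates_comp_inl hf ha
    by_cases hv0 : 0 < (f (.inl v) : ℕ)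
    · have := key _ hf' hv0
      omega
    · have := domNumber_le hf'
      have := (h4 ha).1
      omega
  · obtain ⟨f', hf', hw', hp⟩ := hf.exists_transfer hG
    have := key f' hf' (hp (by omega))
    omega

theorem domNumber_eq_addPathThree_of_mem_zeroSet (hG : NoIsolated G)
    (he : domNumber False G = domNumber True G) (hv : v ∈ zeroSet G) :
    domNumber False (addPathThree G v) = domNumber True (addPathThree G v) := by
  have h1 := domNumber_addPathThree_le (R := True) (v := v) hG
  have h2 := domNumber_add_three_le_of_mem_zeroSet hG hv
  have h4 := domNumber_mono (G := addPathThree G v) (hG.joinAt noIsolated_path_three)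
    (False.elim : False → True)
  omega

/-- A minimum TR2DF positive at `v` could be extended to the path for two units instead of three. -/
theorem mem_zeroSet_of_addPathThree (hG : NoIsolated G)
    (hle : domNumber True G + 3 ≤ domNumber True (addPathThree G v))
    (he : domNumber False (addPathThree G v) = domNumber True (addPathThree G v)) :
    domNumber False G = domNumber True G ∧ v ∈ zeroSet G := by
  have h1 := domNumber_addPathThree_le (R := False) (v := v) hG
  have h4 := domNumber_mono hG (False.elim : False → True)
  refine ⟨by omega, mem_zeroSet_iff.2 fun g hg hw => ?_⟩
  by_contra h0
  have h5 := domNumber_le (hg.addPathThree_zero_one_one (v := v) (by omega))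
  rw [weight_addPathThree] at h5
  simp at h5
  omega

/-- A total Roman dominating function can be shortened by the last two or by all three of the
vertices of a pendant path. -/
theorem Dominates.addPathThree_restrict {f : V ⊕ Fin 3 → Fin 3}
    (hf : Dominates True (addPathThree G v) f) :
    (∃ f', Dominates True (addLeaf G v) f' ∧ weight f' + 2 ≤ weight f) ∨
      ∃ f', Dominates True G f' ∧ weight f' + 3 ≤ weight f := by
  classical
  obtain ⟨h1, h2, h3, h4⟩ := hf.addPathThree_facts
  have hw := weight_addPathThree f
  have h5 := fin_three_le_two (f (.inr 0))
  have h6 := fin_three_le_two (f (.inl v))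
  have hv := hf (.inl v)
  rw [domAt_joinAt_inl_self] at hv
  have hother : ∀ a, a ≠ v → DomAt True G (f ∘ Sum.inl) a := fun a ha =>
    (domAt_joinAt_inl_of_ne ha).1 (hf (.inl a))
  -- the first alternative holds whenever `v` gets a positive label
  have hfirst : ∀ c d : Fin 3, 0 < (c : ℕ) → (f (.inl v) : ℕ) ≤ c →
      (0 < (d : ℕ) ∨ (c : ℕ) = 2 ∧ (f (.inr 0) : ℕ) = 0) →
      (c : ℕ) + d + 2 ≤ f (.inl v) + (f (.inr 0) + f (.inr 1) + f (.inr 2)) →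
      ∃ f', Dominates True (addLeaf G v) f' ∧ weight f' + 2 ≤ weight f := by
    intro c d hc hcv hd hcd
    have hle : ∀ z, (f (.inl z) : ℕ) ≤ Function.update (f ∘ Sum.inl) v c z := by
      intro z
      by_cases hzv : z = v
      · subst hzv
        simpa using hcv
      · simp [hzv]
    refine ⟨Sum.elim (Function.update (f ∘ Sum.inl) v c) fun _ => d, ?_, ?_⟩
    · rintro (a | a)
      · by_cases ha : a = v
        · subst ha
          by_cases hd0 : 0 < (d : ℕ)
          · exact domAt_of_pos (w := .inr ()) (by simpa using hc) (by simp) (by simpa using hd0)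
          · have : 0 < nbrWeight G (f ∘ Sum.inl) a := by omega
            obtain ⟨z, hz, hz0⟩ := nbrWeight_pos.1 this
            exact domAt_of_pos (w := .inl z) (by simpa using hc) (by simpa using hz)
              (by simpa using hz0.trans_le (hle z))
        · rw [domAt_joinAt_inl_of_ne ha, Sum.elim_comp_inl]
          exact (hother a ha).of_le (fun z _ => hle z) (by simp [ha])
      · by_cases hd0 : 0 < (d : ℕ)
        · exact domAt_of_pos (w := .inl v) (by simpa using hd0) (by simp) (by simpa using hc)
        · exact domAt_of_two (w := .inl v) (by simp) (by simp; omega)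
    · have h7 := weight_update (f ∘ Sum.inl) v c
      rw [weight_addLeaf_elim]
      simp only [Function.comp_apply] at h7
      omega
  -- If `v` is zero and the first path vertex is not two, `v` is served from within `G`, and the
  -- path, which weighs at least three, can be dropped. In all other cases a leaf at a positive `v`
  -- replaces the path.
  by_cases hv0 : (f (.inl v) : ℕ) = 0
  · by_cases ha2 : (f (.inr 0) : ℕ) = 2
    · exact .inl (hfirst 1 1 (by simp) (by omega) (.inl (by simp)) (by simp only [Fin.val_one]; omega))
    · right
      refine ⟨f ∘ Sum.inl, fun a => ?_, ?_⟩
      · by_cases ha : a = v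
        · subst ha
          obtain ⟨z, hz, hz2⟩ := ((hv.2 hv0).2 trivial).resolve_right ha2
          exact domAt_of_two hz hz2
        · exact hother a ha
      · by_cases ha : (f (.inr 0) : ℕ) = 0
        · have := (h4 ha).1
          omega
        · omega
  · left
    by_cases ha : (f (.inr 0) : ℕ) = 0
    · by_cases h2v : (f (.inl v) : ℕ) = 2
      · exact hfirst (f (.inl v)) 0 (by omega) le_rfl (.inr ⟨h2v, ha⟩) (by simp only [Fin.val_zero]; omega)
      · have := ((h4 ha).2 trivial).resolve_right h2v
        exact hfirst (f (.inl v)) 1 (by omega) le_rfl (.inl (by simp)) (by simp only [Fin.val_one]; omega)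
    · exact hfirst (f (.inl v)) (f (.inr 0)) (by omega) le_rfl (.inl (by omega)) (by omega)

end AddPathThree

/-! ### Attaching a tree `R_r` (`F1`) -/

section AddTreeR

variable {V : Type*} [Fintype V] {G : SimpleGraph V} {v : V} {R : Prop} {r : ℕ}

@[simp] theorem treeR_adj_inl_inr {a : Unit} {b : Fin r × Fin 4} :
    (treeR r).Adj (.inl a) (.inr b) ↔ b.2 = 1 := by
  simp [treeR]

@[simp] theorem treeR_adj_inr_inl {a : Unit} {b : Fin r × Fin 4} :
    (treeR r).Adj (.inr b) (.inl a) ↔ b.2 = 1 := by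
  rw [adj_comm, treeR_adj_inl_inr]

@[simp] theorem treeR_adj_inr_inr {a b : Fin r × Fin 4} :
    (treeR r).Adj (.inr a) (.inr b) ↔ a.1 = b.1 ∧ (pathGraph 4).Adj a.2 b.2 := by
  simp only [treeR, fromRel_adj, ne_eq, Sum.inr.injEq]
  constructor
  · rintro ⟨-, h | h⟩
    · exact h
    · exact ⟨h.1.symm, h.2.symm⟩
  · rintro ⟨h1, h2⟩
    refine ⟨?_, .inl ⟨h1, h2⟩⟩
    rintro rfl
    exact h2.ne rfl

theorem path_four_adj_zero (x : Fin 4) : (pathGraph 4).Adj 0 x ↔ x = 1 := by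
  fin_cases x <;> simp [pathGraph_adj]

theorem path_four_adj_one (x : Fin 4) : (pathGraph 4).Adj 1 x ↔ x = 0 ∨ x = 2 := by
  fin_cases x <;> simp [pathGraph_adj]

theorem path_four_adj_two (x : Fin 4) : (pathGraph 4).Adj 2 x ↔ x = 1 ∨ x = 3 := by
  fin_cases x <;> simp [pathGraph_adj]

theorem path_four_adj_three (x : Fin 4) : (pathGraph 4).Adj 3 x ↔ x = 2 := by
  fin_cases x <;> simp [pathGraph_adj]

theorem isLeaf_treeR_zero (i : Fin r) : IsLeaf (treeR r) (.inr (i, 0)) := by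
  refine isLeaf_of_forall (w := .inr (i, 1)) (by simp [path_four_adj_zero]) ?_
  rintro (a | ⟨j, a⟩)
  · simp
  · simp only [treeR_adj_inr_inr, path_four_adj_zero]
    rintro ⟨rfl, rfl⟩
    rfl

theorem isLeaf_treeR_three (i : Fin r) : IsLeaf (treeR r) (.inr (i, 3)) := by
  refine isLeaf_of_forall (w := .inr (i, 2)) (by simp [path_four_adj_three]) ?_
  rintro (a | ⟨j, a⟩)
  · simp
  · simp only [treeR_adj_inr_inr, path_four_adj_three]
    rintro ⟨rfl, rfl⟩
    rfl

theorem noIsolated_treeR (hr : 1 ≤ r) : NoIsolated (treeR r) := by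
  rintro (a | ⟨i, a⟩)
  · exact ⟨.inr (⟨0, hr⟩, 1), by simp⟩
  · fin_cases a
    · exact ⟨.inr (i, 1), by simp [path_four_adj_zero]⟩
    · exact ⟨.inr (i, 2), by simp [path_four_adj_one]⟩
    · exact ⟨.inr (i, 1), by simp [path_four_adj_two]⟩
    · exact ⟨.inr (i, 2), by simp [path_four_adj_three]⟩

theorem weight_treeR (f : Unit ⊕ Fin r × Fin 4 → Fin 3) :
    weight f = f (.inl ()) + ∑ i, (((f (.inr (i, 0)) : ℕ) + f (.inr (i, 1))) +
      (f (.inr (i, 2)) + f (.inr (i, 3)))) := by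
  simp [weight, Fintype.sum_sum_type, Fintype.sum_prod_type, Fin.sum_univ_four, add_assoc]

/-- The tree `R_r` is attached to `v` by its centre. -/
abbrev addTreeR (G : SimpleGraph V) (v : V) (r : ℕ) : SimpleGraph (V ⊕ (Unit ⊕ Fin r × Fin 4)) :=
  joinAt G (treeR r) v (.inl ())

/-- Each copy of `P_4` consists of two edges at leaves and weighs at least four. The label of the
centre is not lost but moved into `G`. -/
theorem domNumber_add_le_addTreeR (hG : NoIsolated G) (hr : 1 ≤ r) :
    domNumber R G + 4 * r ≤ domNumber R (addTreeR G v r) := by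
  refine le_domNumber (hG.joinAt (noIsolated_treeR hr)) fun f hf => ?_
  obtain ⟨f', hf', hw, -⟩ := hf.exists_transfer hG
  have h1 := domNumber_le hf'
  rw [weight_sum, weight_treeR]
  have h2 : ∑ i : Fin r, 4 ≤ ∑ i : Fin r, (((f (.inr (.inr (i, 0))) : ℕ) + f (.inr (.inr (i, 1)))) +
      (f (.inr (.inr (i, 2))) + f (.inr (.inr (i, 3))))) := by
    refine Finset.sum_le_sum fun i _ => ?_
    have h3 := hf.eq_two_or_of_isLeaf (v := .inr (.inr (i, 1))) (w := .inr (.inr (i, 0)))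
      (by simp [path_four_adj_one]) (isLeaf_joinAt_inr (isLeaf_treeR_zero i) (by simp))
    have h4 := hf.eq_two_or_of_isLeaf (v := .inr (.inr (i, 2))) (w := .inr (.inr (i, 3)))
      (by simp [path_four_adj_two]) (isLeaf_joinAt_inr (isLeaf_treeR_three i) (by simp))
    omega
  simp only [Finset.sum_const, Finset.card_univ, Fintype.card_fin, smul_eq_mul] at h2
  simp only [Function.comp_apply]
  omega

theorem domNumber_addTreeR_le (hG : NoIsolated G) (hr : 1 ≤ r) :
    domNumber R (addTreeR G v r) ≤ domNumber R G + 4 * r := by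
  obtain ⟨g, hg, hw⟩ := exists_dominates_weight_eq R hG
  -- In each copy the two twos serve each other, their leaves and the centre, independently of `G`.
  have hd : Dominates R (addTreeR G v r)
      (Sum.elim g (Sum.elim (fun _ => 0) fun b => (![0, 2, 2, 0] : Fin 4 → Fin 3) b.2)) := by
    rintro (a | a | ⟨i, a⟩)
    · exact DomAt.joinAt_inl (by simpa using hg a)
    · exact domAt_of_two (w := .inr (.inr (⟨0, hr⟩, 1))) (by simp) (by simp)
    · fin_cases a
      · exact domAt_of_two (w := .inr (.inr (i, 1))) (by simp [path_four_adj_zero]) (by simp)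
      · exact domAt_of_two (w := .inr (.inr (i, 2))) (by simp [path_four_adj_one]) (by simp)
      · exact domAt_of_two (w := .inr (.inr (i, 1))) (by simp [path_four_adj_two]) (by simp)
      · exact domAt_of_two (w := .inr (.inr (i, 2))) (by simp [path_four_adj_three]) (by simp)
  refine (domNumber_le hd).trans ?_
  rw [weight_sum, weight_treeR, ← hw]
  simp
  omega

theorem domNumber_addTreeR (hG : NoIsolated G) (hr : 1 ≤ r) :
    domNumber R (addTreeR G v r) = domNumber R G + 4 * r :=
  le_antisymm (domNumber_addTreeR_le hG hr) (domNumber_add_le_addTreeR hG hr)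

end AddTreeR

/-! ### Identification as the addition of two leaves -/

section Identify

variable {V : Type*} {G : SimpleGraph V} {v : V}

/-- Identifying the support vertex of a path of order three with `v` adds two leaves at `v`. -/
def identifyAtIso (G : SimpleGraph V) (v : V) :
    identifyAt G (pathGraph 3) v 1 ≃g addTwoLeaves G v where
  toFun
    | .inl a => .inl (.inl a)
    | .inr ⟨b, _⟩ => if b = 0 then .inl (.inr ()) else .inr ()
  invFun
    | .inl (.inl a) => .inl a
    | .inl (.inr ()) => .inr ⟨0, by simp⟩
    | .inr () => .inr ⟨2, by simp⟩
  left_inv := by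
    rintro (a | ⟨b, hb⟩)
    · rfl
    · fin_cases b
      · rfl
      · exact absurd rfl hb
      · rfl
  right_inv := by
    rintro ((a | a) | a) <;> rfl
  map_rel_iff' := by
    rintro (a | ⟨a, ha⟩) (b | ⟨b, hb⟩)
    · simp [identifyAt]
      exact ⟨fun h => ⟨h.ne, .inl h⟩, fun h => h.2.elim id fun h => h.symm⟩
    · fin_cases b
      · simp [identifyAt, path_three_adj_one]
      · exact absurd rfl hb
      · simp [identifyAt, path_three_adj_one]
    · fin_cases a
      · simp [identifyAt, path_three_adj_one]
      · exact absurd rfl ha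
      · simp [identifyAt, path_three_adj_one]
    · fin_cases a <;> fin_cases b <;>
        first
        | exact absurd rfl ha
        | exact absurd rfl hb
        | simp [identifyAt, path_three_adj_zero, path_three_adj_two]

end Identify

/-! ### The operations preserve equality -/

theorem domNumber_path_two {R : Prop} : domNumber R (pathGraph 2) = 2 := by
  refine le_antisymm ?_ (le_domNumber noIsolated_path_two fun f hf => ?_)
  · refine (domNumber_le (dominates_const_one noIsolated_path_two)).trans ?_
    simp [weight]
  · obtain ⟨x, hx, hx0⟩ := nbrWeight_pos.1 (hf 0).1
    obtain ⟨y, hy, hy0⟩ := nbrWeight_pos.1 (hf 1).1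
    rw [path_two_adj_zero] at hx
    rw [path_two_adj_one] at hy
    subst hx hy
    simp only [weight, Fin.sum_univ_two]
    omega

theorem Operation.domNumber_eq {V W : Type u} [Fintype V] [Fintype W] {T' : SimpleGraph V}
    {T : SimpleGraph W} (h : Operation T' T) (hT : NoIsolated T')
    (he : domNumber False T' = domNumber True T') :
    NoIsolated T ∧ domNumber False T = domNumber True T := by
  cases h with
  | F1 r hr v e =>
    refine ⟨(hT.joinAt (noIsolated_treeR hr)).of_iso e, ?_⟩
    rw [domNumber_congr _ e, domNumber_congr _ e]
    exact (domNumber_addTreeR hT hr).trans (he ▸ (domNumber_addTreeR hT hr).symm)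
  | F2 v hv e =>
    refine ⟨hT.joinAt_bot.of_iso e, ?_⟩
    rw [domNumber_congr _ e, domNumber_congr _ e]
    exact domNumber_eq_addLeaf_of_mem_supportTR2 hT he hv
  | F3 v hv e =>
    refine ⟨hT.joinAt_bot.of_iso e, ?_⟩
    rw [domNumber_congr _ e, domNumber_congr _ e]
    exact domNumber_eq_addLeaf_of_mem_supportOne hT he hv
  | F4 v hv e =>
    refine ⟨(hT.joinAt noIsolated_path_two).of_iso e, ?_⟩
    rw [domNumber_congr _ e, domNumber_congr _ e]
    exact domNumber_eq_addPathTwo hT he (domNumber_False_add_two_le_of_mem_supportAdj hT hv)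
  | F5 v hv e =>
    have e' := e.trans (identifyAtIso T' v)
    refine ⟨hT.joinAt_bot.joinAt_bot.of_iso e', ?_⟩
    rw [domNumber_congr _ e', domNumber_congr _ e']
    exact domNumber_eq_addTwoLeaves_of_mem_leafTR1 hT he hv
  | F6 v hs hv e =>
    refine ⟨(hT.joinAt noIsolated_path_two).of_iso e, ?_⟩
    rw [domNumber_congr _ e, domNumber_congr _ e]
    exact domNumber_eq_addPathTwo_of_isNearStable hT he hs hv
  | F7 v hv e =>
    refine ⟨(hT.joinAt noIsolated_path_three).of_iso e, ?_⟩
    rw [domNumber_congr _ e, domNumber_congr _ e]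
    exact domNumber_eq_addPathThree_of_mem_zeroSet hT he hv

/-- The `Fintype` instance is quantified in the conclusion because `FamilyF` fixes none on its last
graph; the induction hypothesis then applies to the instance carried by the operation. -/
theorem FamilyF.domNumber_eq {V : Type u} {T : SimpleGraph V} (h : FamilyF T) :
    ∀ [Fintype V], NoIsolated T ∧ domNumber False T = domNumber True T := by
  induction h with
  | base T e =>
    intro _
    refine ⟨noIsolated_path_two.of_iso e, ?_⟩
    rw [domNumber_congr _ e, domNumber_congr _ e, domNumber_path_two, domNumber_path_two]
  | step T' T h' h ih => exact h.domNumber_eq ih.1 ih.2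

/-! ### Splitting a tree along an edge -/

section Split

variable {V W V' W' : Type*} {G : SimpleGraph V} {H : SimpleGraph W} {G' : SimpleGraph V'}
  {H' : SimpleGraph W'} {T : SimpleGraph V} {v : V} {x : W}

/-- Joining two graphs is symmetric. -/
def joinAtSwap (G : SimpleGraph V) (H : SimpleGraph W) (v : V) (x : W) :
    joinAt G H v x ≃g joinAt H G x v where
  toEquiv := Equiv.sumComm V W
  map_rel_iff' := by
    rintro (a | a) (b | b) <;> simp [and_comm]

/-- Collapsing the second part onto `v` turns each step of a walk into a step in `G` or a halt. -/
theorem connected_of_joinAt (h : (joinAt G H v x).Connected) : G.Connected := by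
  have key : ∀ p q : V ⊕ W, (joinAt G H v x).Reachable p q →
      G.Reachable (Sum.elim id (fun _ => v) p) (Sum.elim id (fun _ => v) q) := by
    rintro p q ⟨w⟩
    induction w with
    | nil => rfl
    | @cons a b c hab _ ih =>
      refine .trans ?_ ih
      rcases a with a | a <;> rcases b with b | b
      · exact (joinAt_adj_inl_inl.1 hab).reachable
      · rw [(joinAt_adj_inl_inr.1 hab).1]; rfl
      · rw [(joinAt_adj_inr_inl.1 hab).1]; rfl
      · rfl
  have : Nonempty V := ⟨v⟩
  exact ⟨fun a b => key (.inl a) (.inl b) (h.preconnected _ _)⟩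

theorem isTree_of_joinAt (h : (joinAt G H v x).IsTree) : G.IsTree :=
  ⟨connected_of_joinAt h.1, h.2.comap (f := ⟨Sum.inl, fun h => by simpa using h⟩)
    Sum.inl_injective⟩

theorem isTree_left_of_iso {v' : V'} {x' : W'} (e : T ≃g joinAt G' H' v' x') (h : T.IsTree) : G'.IsTree :=
  isTree_of_joinAt (e.isTree_iff.1 h)

/-- A graph splits along an edge that is the only one between `S` and the image of `H`. -/
theorem exists_iso_joinAt (S : Set V) (φ : H ↪g T) (hφ : ∀ a, a ∉ S ↔ a ∈ Set.range φ) (v : S) (x : W)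
    (hvx : T.Adj v (φ x)) (h : ∀ a ∈ S, ∀ b, T.Adj a (φ b) → a = v ∧ b = x) :
    ∃ e : T ≃g joinAt (T.induce S) H v x, ∀ a : S, e a = .inl a := by
  let f : S ⊕ W → V := Sum.elim Subtype.val φ
  have hf : Function.Bijective f := by
    refine ⟨Function.Injective.sumElim Subtype.val_injective φ.injective ?_, fun a => ?_⟩
    · rintro ⟨a, ha⟩ b rfl
      exact (hφ _).2 ⟨b, rfl⟩ ha
    · by_cases ha : a ∈ S
      · exact ⟨.inl ⟨a, ha⟩, rfl⟩
      · obtain ⟨b, hb⟩ := (hφ a).1 ha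
        exact ⟨.inr b, hb⟩
  have key : ∀ (a : S) (b : W), T.Adj a (φ b) ↔ a = v ∧ b = x := fun a b =>
    ⟨fun hab => ⟨Subtype.ext (h a a.2 b hab).1, (h a a.2 b hab).2⟩, by rintro ⟨rfl, rfl⟩; exact hvx⟩
  refine ⟨RelIso.symm ⟨Equiv.ofBijective f hf, ?_⟩,
    fun a => (Equiv.ofBijective f hf).symm_apply_apply (.inl a)⟩
  rintro (a | a) (b | b)
  · simp [f]
  · simp [f, key]
  · simp [f, T.adj_comm, key]
  · simp [f]

/-- Every edge of a tree is a bridge; `S` is the component of `u` after its deletion. -/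
theorem exists_split (hT : T.IsTree) {u b : V} (hub : T.Adj u b) :
    ∃ (S : Set V) (hu : u ∈ S) (hb : b ∈ Sᶜ),
      ∃ e : T ≃g joinAt (T.induce S) (T.induce Sᶜ) ⟨u, hu⟩ ⟨b, hb⟩, e u = .inl ⟨u, hu⟩ := by
  have hbr := isAcyclic_iff_forall_adj_isBridge.1 hT.2 hub
  rw [isBridge_iff] at hbr
  let S : Set V := {a | (T.deleteEdges {s(u, b)}).Reachable u a}
  have hu : u ∈ S := Reachable.refl _
  have hb : b ∈ Sᶜ := hbr
  have hS : ∀ a ∈ S, ∀ c : ↑Sᶜ, T.Adj a (Embedding.induce (G := T) Sᶜ c) →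
      a = (⟨u, hu⟩ : S) ∧ c = ⟨b, hb⟩ := by
    rintro a ha ⟨c, hc⟩ hac
    by_cases hs : s(a, c) = s(u, b)
    · rcases Sym2.eq_iff.1 hs with ⟨rfl, rfl⟩ | ⟨rfl, rfl⟩
      · exact ⟨rfl, rfl⟩
      · exact absurd ha hbr
    · refine absurd (Reachable.trans ha (Adj.reachable ?_)) hc
      exact deleteEdges_adj.2 ⟨hac, hs⟩
  obtain ⟨e, he⟩ := exists_iso_joinAt S (Embedding.induce Sᶜ) (fun a => by simp) ⟨u, hu⟩
    ⟨b, hb⟩ hub hS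
  exact ⟨S, hu, hb, e, he ⟨u, hu⟩⟩

end Split

/-! ### Root costs and their recursion -/

/-- Whether a root labelled `l` whose neighbours have total weight `n` is in the `k`-th state. -/
def RootState (k : Fin 7) (l n : ℕ) : Prop :=
  l = (![0, 0, 0, 1, 1, 2, 2] : Fin 7 → ℕ) k ∧ (![0, 1, 2, 0, 1, 0, 1] : Fin 7 → ℕ) k ≤ n

section RootCost

variable {V W : Type*} [Fintype V] [Fintype W] {G : SimpleGraph V} {H : SimpleGraph W}
  {v u : V} {x : W} {k i j : Fin 7} {f : V → Fin 3}

/-- Every vertex but the root `u` is dominated, and the root is in the `k`-th state. -/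
def IsRootState (G : SimpleGraph V) (u : V) (k : Fin 7) (f : V → Fin 3) : Prop :=
  RootState k (f u) (nbrWeight G f u) ∧ ∀ a, a ≠ u → DomAt False G f a

/-- The least weight of a function that dominates every vertex but the root `u`, which is in the
`k`-th state. -/
noncomputable def rootCost (G : SimpleGraph V) (u : V) (k : Fin 7) : ℕ∞ :=
  ⨅ f, ⨅ (_ : IsRootState G u k f), (weight f : ℕ∞)

theorem rootCost_le (h : IsRootState G u k f) : rootCost G u k ≤ weight f :=
  iInf₂_le f h

theorem exists_of_rootCost_ne_top (h : rootCost G u k ≠ ⊤) :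
    ∃ f, IsRootState G u k f ∧ rootCost G u k = weight f := by
  by_contra! hc
  have hne : ∃ f, IsRootState G u k f := by
    by_contra! h'
    exact h (by simp [rootCost, h'])
  classical
  let p : ℕ → Prop := fun n => ∃ f, IsRootState G u k f ∧ weight f = n
  have hp : ∃ n, p n := ⟨_, hne.choose, hne.choose_spec, rfl⟩
  obtain ⟨f, hf, hw⟩ := Nat.find_spec hp
  refine hc f hf (le_antisymm (rootCost_le hf) (le_iInf₂ fun g hg => ?_))
  rw [hw]
  exact_mod_cast Nat.find_min' hp ⟨g, hg, rfl⟩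

theorem le_rootCost_of_iso {G' : SimpleGraph W} (e : G ≃g G') (u : V) (k : Fin 7) :
    rootCost G u k ≤ rootCost G' (e u) k := by
  refine le_iInf₂ fun f hf => ?_
  rw [← weight_comp_equiv e.toEquiv f]
  refine rootCost_le ⟨?_, fun a ha => ?_⟩
  · have h := hf.1
    rw [← nbrWeight_comp_iso e f u] at h
    exact h
  · have h := hf.2 (e a) (by simpa using ha)
    simp only [DomAt, false_imp_iff, and_true] at h ⊢
    rw [← nbrWeight_comp_iso e f a] at h
    exact h

theorem rootCost_congr {G' : SimpleGraph W} (e : G ≃g G') (u : V) :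
    rootCost G u = rootCost G' (e u) := by
  funext k
  refine le_antisymm (le_rootCost_of_iso e u k) ?_
  simpa using le_rootCost_of_iso e.symm (e u) k

theorem isRootState_joinAt_iff {f : V ⊕ W → Fin 3} : IsRootState (joinAt G H v x) (.inl v) k f ↔
    RootState k (f (.inl v)) (nbrWeight G (f ∘ Sum.inl) v + f (.inr x)) ∧
    (0 < nbrWeight H (f ∘ Sum.inr) x + f (.inl v) ∧
      ((f (.inr x) : ℕ) = 0 → 2 ≤ nbrWeight H (f ∘ Sum.inr) x + f (.inl v))) ∧
    (∀ a, a ≠ v → DomAt False G (f ∘ Sum.inl) a) ∧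
    (∀ b, b ≠ x → DomAt False H (f ∘ Sum.inr) b) := by
  rw [IsRootState, nbrWeight_joinAt_inl_self]
  refine and_congr_right fun _ => ⟨fun h => ⟨?_, fun a ha => ?_, fun b hb => ?_⟩, ?_⟩
  · have := domAt_joinAt_inr_self.1 (h (.inr x) (by simp))
    exact ⟨this.1, fun h0 => (this.2 h0).1⟩
  · exact (domAt_joinAt_inl_of_ne ha).1 (h (.inl a) (by simpa using ha))
  · exact (domAt_joinAt_inr_of_ne hb).1 (h (.inr b) (by simp))
  · rintro ⟨h1, h2, h3⟩ (a | b) hne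
    · have ha : a ≠ v := by simpa using hne
      exact (domAt_joinAt_inl_of_ne ha).2 (h2 a ha)
    · by_cases hb : b = x
      · subst hb
        exact domAt_joinAt_inr_self.2 ⟨h1.1, fun h0 => ⟨h1.2 h0, False.elim⟩⟩
      · exact (domAt_joinAt_inr_of_ne hb).2 (h3 b hb)

theorem rootCost_joinAt_le (h : ∀ l n c m, RootState i l n → RootState j c m →
      RootState k l (n + c) ∧ 0 < m + l ∧ (c = 0 → 2 ≤ m + l)) :
    rootCost (joinAt G H v x) (.inl v) k ≤ rootCost G v i + rootCost H x j := by
  by_cases h1 : rootCost G v i = ⊤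
  · simp [h1]
  by_cases h2 : rootCost H x j = ⊤
  · simp [h2]
  obtain ⟨f, hf, hfw⟩ := exists_of_rootCost_ne_top h1
  obtain ⟨g, hg, hgw⟩ := exists_of_rootCost_ne_top h2
  rw [hfw, hgw]
  have := h _ _ _ _ hf.1 hg.1
  refine (rootCost_le (f := Sum.elim f g) (isRootState_joinAt_iff.2
    ⟨this.1, this.2, hf.2, hg.2⟩)).trans ?_
  rw [weight_sum]
  exact_mod_cast le_rfl

theorem add_le_weight {f : V ⊕ W → Fin 3} (hf : IsRootState (joinAt G H v x) (.inl v) k f)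
    (hi : RootState i (f (.inl v)) (nbrWeight G (f ∘ Sum.inl) v))
    (hj : RootState j (f (.inr x)) (nbrWeight H (f ∘ Sum.inr) x)) :
    rootCost G v i + rootCost H x j ≤ weight f := by
  have h := isRootState_joinAt_iff.1 hf
  rw [weight_sum]
  push_cast
  exact add_le_add (rootCost_le ⟨hi, h.2.2.1⟩) (rootCost_le ⟨hj, h.2.2.2⟩)

/-- The three pairs of states correspond to the labels zero, one and two of `x`: each label
determines what `v` still needs from `G` and `x` from `H`. States record lower bounds on neighbour
weight, so seven of them suffice. -/
theorem rootCost_joinAt_eq {i₁ j₁ i₂ j₂ i₃ j₃ : Fin 7}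
    (h₁ : ∀ l n c m, RootState i₁ l n → RootState j₁ c m →
      RootState k l (n + c) ∧ 0 < m + l ∧ (c = 0 → 2 ≤ m + l))
    (h₂ : ∀ l n c m, RootState i₂ l n → RootState j₂ c m →
      RootState k l (n + c) ∧ 0 < m + l ∧ (c = 0 → 2 ≤ m + l))
    (h₃ : ∀ l n c m, RootState i₃ l n → RootState j₃ c m →
      RootState k l (n + c) ∧ 0 < m + l ∧ (c = 0 → 2 ≤ m + l))
    (h : ∀ l n c m, c ≤ 2 → RootState k l (n + c) → 0 < m + l → (c = 0 → 2 ≤ m + l) →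
      RootState i₁ l n ∧ RootState j₁ c m ∨ RootState i₂ l n ∧ RootState j₂ c m ∨
        RootState i₃ l n ∧ RootState j₃ c m) :
    rootCost (joinAt G H v x) (.inl v) k = min (rootCost G v i₁ + rootCost H x j₁)
      (min (rootCost G v i₂ + rootCost H x j₂) (rootCost G v i₃ + rootCost H x j₃)) := by
  refine le_antisymm (le_min (rootCost_joinAt_le h₁)
    (le_min (rootCost_joinAt_le h₂) (rootCost_joinAt_le h₃))) (le_iInf₂ fun f hf => ?_)
  have hf' := isRootState_joinAt_iff.1 hf
  rcases h _ _ _ _ (fin_three_le_two _) hf'.1 hf'.2.1.1 hf'.2.1.2 with h | h | h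
  · exact (min_le_left _ _).trans (add_le_weight hf h.1 h.2)
  · exact ((min_le_right _ _).trans (min_le_left _ _)).trans (add_le_weight hf h.1 h.2)
  · exact ((min_le_right _ _).trans (min_le_right _ _)).trans (add_le_weight hf h.1 h.2)

theorem rootCost_joinAt : rootCost (joinAt G H v x) (.inl v) =
    joinCost (rootCost G v) (rootCost H x) := by
  funext k
  fin_cases k
  all_goals
    refine rootCost_joinAt_eq ?_ ?_ ?_ ?_ <;> intro l n c m <;>
      simp only [RootState, Matrix.cons_val, Fin.mk_zero, Fin.mk_one, Fin.reduceFinMk] <;> omega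

theorem costInv_of_subsingleton [Subsingleton V] (G : SimpleGraph V) (u : V) :
    CostInv (rootCost G u) := by
  refine .inr (.inr ?_)
  have hadj : ∀ a b, ¬ G.Adj a b := fun a b h => h.ne (Subsingleton.elim a b)
  have hn : ∀ f, nbrWeight G f u = 0 := fun f => by
    by_contra h
    obtain ⟨x, hx, -⟩ := nbrWeight_pos.1 (Nat.pos_of_ne_zero h)
    exact hadj _ _ hx
  have huniv : (Finset.univ : Finset V) = {u} := Finset.eq_singleton_iff_unique_mem.2
    ⟨Finset.mem_univ _, fun a _ => Subsingleton.elim a u⟩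
  have hw : ∀ f : V → Fin 3, weight f = f u := fun f => by simp [weight, huniv]
  have hst : ∀ k f, IsRootState G u k f ↔ RootState k (f u) 0 := fun k f => by
    rw [IsRootState, hn]
    exact and_iff_left fun a ha => absurd (Subsingleton.elim a u) ha
  have htop : ∀ k, (∀ l, ¬ RootState k l 0) → rootCost G u k = ⊤ := fun k h => by
    simp [rootCost, hst, h]
  have hval : ∀ k (c : Fin 3), RootState k c 0 → rootCost G u k = (c : ℕ) := fun k c h => by
    refine le_antisymm ((rootCost_le (f := fun _ => c) ((hst _ _).2 h)).trans (by rw [hw]))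
      (le_iInf₂ fun f hf => ?_)
    rw [hw, ((hst _ _).1 hf).1, h.1]
  funext k
  fin_cases k
  · exact hval 0 0 (by simp [RootState])
  · exact htop 1 (by simp [RootState])
  · exact htop 2 (by simp [RootState])
  · exact hval 3 1 (by simp [RootState])
  · exact htop 4 (by simp [RootState])
  · exact hval 5 2 (by simp [RootState])
  · exact htop 6 (by simp [RootState])

end RootCost

theorem costInv_rootCost {V : Type*} [Fintype V] {G : SimpleGraph V} (hG : G.IsTree) (u : V) :
    CostInv (rootCost G u) := by
  classical
  induction hn : Fintype.card V using Nat.strong_induction_on generalizing V with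
  | _ n ih =>
    subst hn
    by_cases hc : Fintype.card V ≤ 1
    · have := Fintype.card_le_one_iff_subsingleton.1 hc
      exact costInv_of_subsingleton G u
    · obtain ⟨b, hub⟩ := noIsolated_of_connected hG.1 (by omega) u
      obtain ⟨S, hu, hb, e, he⟩ := exists_split hG hub
      rw [rootCost_congr e u, he, rootCost_joinAt]
      have hl := isTree_left_of_iso e hG
      have hr := isTree_left_of_iso (e.trans (joinAtSwap _ _ _ _)) hG
      refine (ih _ ?_ hl _ rfl).join (ih _ ?_ hr _ rfl)
      · exact Fintype.card_subtype_lt (x := b) hb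
      · exact Fintype.card_subtype_lt (x := u) (not_not_intro hu)

/-! ### The midpoint inequality -/

section Midpoint

variable {V : Type*} [Fintype V] {G : SimpleGraph V} {u : V}

/-- Here `f` is in state `1` at `u` and `g` in state `6`, so `t4 + t4 ≤ t1 + t6` provides the
function in state `4`. The existence of `f` excludes the cost types in which `t1` is infinite. -/
theorem exists_dominates_midpoint (hG : G.IsTree) {f g : V → Fin 3}
    (hf : ∀ a, a ≠ u → DomAt False G f a) (hfu : (f u : ℕ) = 0) (hpos : 0 < nbrWeight G f u)
    (hg : Dominates False G g) (hgu : (g u : ℕ) = 2) :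
    ∃ h, Dominates False G h ∧ (h u : ℕ) = 1 ∧ 2 * weight h ≤ weight f + weight g := by
  have h1 : rootCost G u 1 ≤ weight f :=
    rootCost_le ⟨⟨by simpa using hfu, by simpa using Nat.succ_le_of_lt hpos⟩, hf⟩
  have h6 : rootCost G u 6 ≤ weight g :=
    rootCost_le ⟨⟨by simpa using hgu, by simpa using Nat.succ_le_of_lt (hg u).1⟩, fun a _ => hg a⟩
  have hne : rootCost G u 1 ≠ ⊤ := fun h => by simp [h] at h1
  rcases costInv_rootCost hG u with ⟨t0, t1, t2, t3, t4, t5, t6, ht, hI⟩ | ⟨_, _, _, _, ht, -⟩ | ht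
  · have h4 : rootCost G u 4 = t4 := by rw [ht]; rfl
    have h1' : rootCost G u 1 = t1 := by rw [ht]; rfl
    have h6' : rootCost G u 6 = t6 := by rw [ht]; rfl
    obtain ⟨h, hh, hw⟩ := exists_of_rootCost_ne_top (G := G) (u := u) (k := 4) (by simp [h4])
    rw [h4] at hw
    rw [h1'] at h1
    rw [h6'] at h6
    norm_cast at hw h1 h6
    obtain ⟨-, -, -, -, -, -, -, -, -, hI, -⟩ := hI
    have hs := hh.1
    simp only [RootState, Matrix.cons_val] at hs
    refine ⟨h, fun a => ?_, hs.1, by omega⟩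
    by_cases ha : a = u
    · subst ha
      exact ⟨by omega, fun h0 => by omega⟩
    · exact hh.2 a ha
  · rw [ht] at hne; exact absurd rfl hne
  · rw [ht] at hne; exact absurd rfl hne

end Midpoint

/-! ### A pendant star with two leaves -/

section PendantThree

variable {V : Type*} [Fintype V] {G : SimpleGraph V} {u : V}

theorem nbrWeight_bot (f : Unit → Fin 3) : nbrWeight (⊥ : SimpleGraph Unit) f () = 0 := by
  simp [nbrWeight]

/-- Two leaves at the leaf next to `u`: one of the two possible reductions is tight. -/
theorem domNumber_addTwoLeaves_le_or (hG : G.IsTree)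
    (h₁ : NoIsolated (addLeaf G u)) :
    domNumber False (addTwoLeaves (addLeaf G u) (.inr ())) ≤
        domNumber False (addLeaf (addLeaf G u) (.inr ())) ∨
      domNumber False (addTwoLeaves (addLeaf G u) (.inr ())) ≤
        domNumber False (addLeaf G u) + 1 := by
  by_contra! hc
  obtain ⟨hc2, hc1⟩ := hc
  have h₂ : NoIsolated (addLeaf (addLeaf G u) (.inr ())) := h₁.joinAt_bot
  -- Label two on the centre of the star would make its second leaf free.
  have no2 : ∀ g, Dominates False (addLeaf (addLeaf G u) (.inr ())) g →
      weight g ≤ domNumber False (addLeaf (addLeaf G u) (.inr ())) →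
      (g (.inl (.inr ())) : ℕ) ≠ 2 := by
    intro g hg hw h
    have := domNumber_le (hg.addLeaf_zero h)
    rw [weight_addLeaf_elim] at this
    simp only [Fin.val_zero] at this
    unfold addTwoLeaves at hc2
    omega
  obtain ⟨g, hg, hgw⟩ := exists_dominates_weight_eq False h₂
  have hadj : (addLeaf (addLeaf G u) (.inr ())).Adj (.inl (.inr ())) (.inr ()) := by simp
  have hadj' : (addLeaf (addLeaf G u) (.inr ())).Adj (.inl (.inr ())) (.inl (.inl u)) := by simp
  have hv := (hg.eq_two_or_of_isLeaf hadj isLeaf_addLeaf_inr).resolve_left (no2 g hg hgw.le)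
  -- With `u` positive, the weight of the leaf could be moved onto the centre.
  have hu : (g (.inl (.inl u)) : ℕ) = 0 := by
    by_contra h0
    obtain ⟨g', hg', h2, hw'⟩ := hg.exists_eq_two hadj isLeaf_addLeaf_inr hadj' (by simp)
      (Nat.pos_of_ne_zero h0)
    exact no2 g' hg' (hw'.trans hgw.le) h2
  obtain ⟨k, hk, hkw⟩ := exists_dominates_weight_eq False h₁
  have hkv : (k (.inr ()) : ℕ) = 0 := by
    by_contra h0
    have := domNumber_addTwoLeaves_le hk (Nat.pos_of_ne_zero h0)
    omega
  have hgu := (domAt_joinAt_inl_self.1 ((domAt_joinAt_inl_of_ne (by simp)).1 (hg (.inl (.inl u))))).2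
    hu
  have hkr := domAt_joinAt_inr_self.1 (hk (.inr ()))
  have hkl := domAt_joinAt_inl_self.1 (hk (.inl u))
  rw [nbrWeight_bot] at hkr
  have hk2 := fin_three_le_two (k (.inl u))
  -- On `G`, `g` has label zero and `k` label two at `u`. With two on the centre and zero on both
  -- leaves, the midpoint dominates the whole tree. Twice the resulting weight exceeds the sum of
  -- the two smaller numbers by at most two, while the failure of both alternatives forces an excess
  -- of at least three.
  obtain ⟨m, hm, hmu, hmw⟩ := exists_dominates_midpoint (u := u) hG
    (f := g ∘ Sum.inl ∘ Sum.inl) (g := k ∘ Sum.inl)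
    (fun a ha => (domAt_joinAt_inl_of_ne ha).1 ((domAt_joinAt_inl_of_ne (by simp)).1
      (hg (.inl (.inl a))))) hu (by
        have h1 := hgu.1
        simp only [Function.comp_apply] at h1
        have h2 : nbrWeight G ((g ∘ Sum.inl) ∘ Sum.inl) u = nbrWeight G (g ∘ Sum.inl ∘ Sum.inl) u := rfl
        omega)
    (fun a => by
      by_cases ha : a = u
      · subst ha
        have := hkr.2 hkv
        exact ⟨by omega, fun h => by simp only [Function.comp_apply] at h; omega⟩
      · exact (domAt_joinAt_inl_of_ne ha).1 (hk (.inl a)))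
    (by have := hkr.2 hkv; simp only [Function.comp_apply]; omega)
  have hd : Dominates False (addLeaf G u) (Sum.elim m fun _ => 2) := by
    rintro (a | a)
    · exact DomAt.joinAt_inl (hm a)
    · exact domAt_of_pos (w := .inl u) (by simp) (by simp) (by simp [hmu])
  have hle := domNumber_le ((hd.addLeaf_zero (v := .inr ()) (by simp)).addLeaf_zero
    (v := .inl (.inr ())) (by simp))
  rw [weight_addLeaf_elim, weight_addLeaf_elim, weight_addLeaf_elim] at hle
  rw [weight_sum, weight_sum, weight_unit, weight_unit] at hgw
  rw [weight_sum, weight_unit] at hkw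
  simp only [Function.comp_apply, Fin.val_zero, Fin.val_two] at hle hgw hkw
  have e1 : weight ((g ∘ Sum.inl) ∘ Sum.inl) = weight (g ∘ Sum.inl ∘ Sum.inl) := rfl
  unfold addTwoLeaves at hc2 hc1
  omega

end PendantThree

/-! ### Undoing an operation -/

/-- The graph arises by an operation from a smaller tree on which the two numbers agree. -/
def HasReduction {W : Type u} [Fintype W] (T : SimpleGraph W) : Prop :=
  ∃ (V : Type u) (_ : Fintype V) (T' : SimpleGraph V), T'.IsTree ∧ 2 ≤ Fintype.card V ∧
    Fintype.card V < Fintype.card W ∧ domNumber False T' = domNumber True T' ∧ Operation T' T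

section Reductions

variable {V W : Type u} [Fintype V] [Fintype W] {G : SimpleGraph V} {T : SimpleGraph W}
  {v h y u w : V} {r : ℕ}

theorem two_le_card_of_adj (hv : G.Adj v h) : 2 ≤ Fintype.card V :=
  Fintype.one_lt_card_iff.2 ⟨v, h, hv.ne⟩

theorem hasReduction_addLeaf (e : T ≃g addLeaf G v) (hT : T.IsTree)
    (he : domNumber False T = domNumber True T) (hadj : G.Adj v h) (hl : IsLeaf G h)
    (hy : G.Adj v y) (hyh : y ≠ h) (hyl : IsLeaf G y ∨ IsSupport G y) : HasReduction T := by
  have hG := isTree_left_of_iso e hT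
  have h2 := two_le_card_of_adj hadj
  have hn := noIsolated_of_connected hG.1 h2
  rw [domNumber_congr _ e, domNumber_congr _ e] at he
  obtain ⟨h3, h4⟩ := mem_supportTR2_of_addLeaf hn ⟨h, hadj, hl⟩
    (domNumber_addLeaf_le hn hadj hl hy hyh hyl) he
  exact ⟨V, _, G, hG, h2, by simp [Fintype.card_congr e.toEquiv], h3, .F2 v h4 e⟩

theorem hasReduction_addTwoLeaves (e : T ≃g addTwoLeaves (addLeaf G u) (.inr ())) (hT : T.IsTree)
    (he : domNumber False T = domNumber True T) : HasReduction T := by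
  have hG₂ := isTree_left_of_iso e hT
  have hG₁ := isTree_of_joinAt hG₂
  have hG := isTree_of_joinAt hG₁
  have hadj : (addLeaf G u).Adj (.inr ()) (.inl u) := by simp
  have hl : IsLeaf (addLeaf G u) (.inr ()) := isLeaf_addLeaf_inr
  have h2 := two_le_card_of_adj hadj
  have hn := noIsolated_of_connected hG₁.1 h2
  have hc : Fintype.card W = Fintype.card V + 3 := by simp [Fintype.card_congr e.toEquiv]
  rw [domNumber_congr _ e, domNumber_congr _ e] at he
  rcases domNumber_addTwoLeaves_le_or hG hn with hle | hle
  · have hs : IsSupport (addLeaf (addLeaf G u) (.inr ())) (.inl (.inr ())) :=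
      ⟨.inr (), by simp, isLeaf_addLeaf_inr⟩
    obtain ⟨h3, h4⟩ := mem_supportTR2_of_addLeaf
      (G := addLeaf (addLeaf G u) (.inr ())) (v := .inl (.inr ())) hn.joinAt_bot hs hle he
    exact ⟨(V ⊕ Unit) ⊕ Unit, inferInstance, addLeaf (addLeaf G u) (.inr ()), hG₂,
      by simp, by simp [hc], h3, .F2 _ h4 e⟩
  · obtain ⟨h3, h4⟩ := mem_leafTR1_of_addTwoLeaves hn hl hle he
    exact ⟨V ⊕ Unit, inferInstance, addLeaf G u, hG₁, h2, by simp [hc], h3,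
      .F5 _ h4 (e.trans (identifyAtIso _ _).symm)⟩

theorem hasReduction_addPathTwo (e : T ≃g addPathTwo G v) (hT : T.IsTree)
    (he : domNumber False T = domNumber True T) (hvw : G.Adj v w) (hwh : G.Adj w h)
    (hl : IsLeaf G h) (hv : h ≠ v) : HasReduction T := by
  have hG := isTree_left_of_iso e hT
  have h2 := two_le_card_of_adj hvw
  have hn := noIsolated_of_connected hG.1 h2
  rw [domNumber_congr _ e, domNumber_congr _ e] at he
  obtain ⟨h3, h4⟩ := isNearStable_of_addPathTwo hn
    (domNumber_True_add_two_le_addPathTwo hn hvw hwh hl hv) he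
  refine ⟨V, _, G, hG, h2, by simp [Fintype.card_congr e.toEquiv], h3, .F6 v h4 ?_ e⟩
  exact or_iff_not_imp_left.2 fun h => ⟨h, w, hvw, _, hwh, hl⟩

/-- A pendant path of order three is a pendant path of order two at a new leaf. -/
def addPathThreeIso (G : SimpleGraph V) (v : V) :
    addPathThree G v ≃g addPathTwo (addLeaf G v) (.inr ()) where
  toFun
    | .inl a => .inl (.inl a)
    | .inr b => ![.inl (.inr ()), .inr 0, .inr 1] b
  invFun
    | .inl (.inl a) => .inl a
    | .inl (.inr ()) => .inr 0
    | .inr b => ![.inr 1, .inr 2] b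
  left_inv := by
    rintro (a | b)
    · rfl
    · fin_cases b <;> rfl
  right_inv := by
    rintro ((a | a) | b)
    · rfl
    · rfl
    · fin_cases b <;> rfl
  map_rel_iff' := by
    rintro (a | a) (b | b)
    · simp
    · fin_cases b <;> simp
    · fin_cases a <;> simp
    · fin_cases a <;> fin_cases b <;> simp [path_three_adj_zero, path_three_adj_one,
        path_three_adj_two, path_two_adj_zero, path_two_adj_one]

theorem hasReduction_addPathThree (e : T ≃g addPathThree G v) (hT : T.IsTree)
    (he : domNumber False T = domNumber True T) : HasReduction T := by
  have hG := isTree_left_of_iso e hT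
  have e' := e.trans (addPathThreeIso G v)
  have hG₁ := isTree_left_of_iso e' hT
  have hadj : (addLeaf G v).Adj (.inr ()) (.inl v) := by simp
  have h2 := two_le_card_of_adj hadj
  have hn₁ := noIsolated_of_connected hG₁.1 h2
  have hc : Fintype.card W = Fintype.card V + 3 := by simp [Fintype.card_congr e.toEquiv]
  have hnT := (hn₁.joinAt (x := 0) (v := .inr ()) noIsolated_path_two).of_iso (addPathThreeIso G v)
  obtain ⟨f, hf, hw⟩ := exists_dominates_weight_eq True hnT
  rcases hf.addPathThree_restrict with ⟨f', hf', hw'⟩ | ⟨f', hf', hw'⟩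
  · have h3 := domNumber_le hf'
    rw [domNumber_congr _ (addPathThreeIso G v)] at hw
    rw [domNumber_congr _ e', domNumber_congr _ e'] at he
    obtain ⟨h4, h5⟩ := isNearStable_of_addPathTwo hn₁ (by unfold addPathTwo at hw ⊢; omega) he
    exact ⟨V ⊕ Unit, inferInstance, addLeaf G v, hG₁, h2, by simp [hc], h4, .F6 _ h5 (.inl isLeaf_addLeaf_inr) e'⟩
  · have h3 := domNumber_le hf'
    -- A priori `G` could be a single vertex; the dominating function `f'` rules this out.
    have hn : NoIsolated G := fun a => by
      obtain ⟨x, hx, -⟩ := nbrWeight_pos.1 (hf' a).1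
      exact ⟨x, hx⟩
    rw [domNumber_congr _ e, domNumber_congr _ e] at he
    obtain ⟨h4, h5⟩ := mem_zeroSet_of_addPathThree hn (by omega) he
    obtain ⟨x, hx⟩ := hn v
    exact ⟨V, _, G, hG, two_le_card_of_adj hx, by simp [hc], h4, .F7 v h5 e⟩

theorem hasReduction_addTreeR (e : T ≃g addTreeR G v r) (hr : 1 ≤ r) (hT : T.IsTree)
    (he : domNumber False T = domNumber True T) (hvw : G.Adj v w) : HasReduction T := by
  have hG := isTree_left_of_iso e hT
  have h2 := two_le_card_of_adj hvw
  have hn := noIsolated_of_connected hG.1 h2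
  rw [domNumber_congr _ e, domNumber_congr _ e, domNumber_addTreeR hn hr,
    domNumber_addTreeR hn hr] at he
  exact ⟨V, _, G, hG, h2, by simp [Fintype.card_congr e.toEquiv], by omega, .F1 r hr v e⟩

end Reductions

/-! ### Splitting off pendant subgraphs -/

section Pendant

variable {V W : Type*} {T : SimpleGraph V} {H : SimpleGraph W} {v w : V} {x : W}

/-- A pendant copy of `H` can be split off. -/
theorem exists_iso_of_pendant (φ : W → V) (hφ : Function.Injective φ) (hv : v ∈ (Set.range φ)ᶜ)
    (hvx : T.Adj v (φ x)) (hhom : ∀ s t, H.Adj s t → T.Adj (φ s) (φ t))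
    (hs : ∀ s y, T.Adj (φ s) y → s = x ∧ y = v ∨ ∃ t, H.Adj s t ∧ φ t = y) :
    Nonempty (T ≃g joinAt (T.induce (Set.range φ)ᶜ) H ⟨v, hv⟩ x) := by
  have hadj : ∀ s t, T.Adj (φ s) (φ t) ↔ H.Adj s t := fun s t => by
    refine ⟨fun h => ?_, hhom s t⟩
    rcases hs s _ h with ⟨-, h⟩ | ⟨t', ht, h⟩
    · exact absurd ⟨t, h⟩ hv
    · exact hφ h ▸ ht
  obtain ⟨e, -⟩ := exists_iso_joinAt (T := T) (H := H) (Set.range φ)ᶜ ⟨⟨φ, hφ⟩, hadj _ _⟩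
    (fun a => by simp) ⟨v, hv⟩ x hvx (fun a ha b hab => by
      rcases hs b a hab.symm with ⟨h1, h2⟩ | ⟨t, -, h⟩
      · exact ⟨h2, h1⟩
      · exact absurd ⟨t, h⟩ ha)
  exact ⟨e⟩

theorem isLeaf_induce {S : Set V} (hl : IsLeaf T v) (hvw : T.Adj v w) (hv : v ∈ S) (hw : w ∈ S) :
    IsLeaf (T.induce S) ⟨v, hv⟩ :=
  isLeaf_of_forall (w := ⟨w, hw⟩) hvw fun _ hy => Subtype.ext (hl.eq_of_adj hy hvw)

/-- A pendant star with two leaves. -/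
def joinStarIso (G : SimpleGraph V) (v : V) :
    joinAt G (pathGraph 3) v 1 ≃g addTwoLeaves (addLeaf G v) (.inr ()) where
  toFun
    | .inl a => .inl (.inl (.inl a))
    | .inr b => ![.inl (.inr ()), .inl (.inl (.inr ())), .inr ()] b
  invFun
    | .inl (.inl (.inl a)) => .inl a
    | .inl (.inl (.inr ())) => .inr 1
    | .inl (.inr ()) => .inr 0
    | .inr () => .inr 2
  left_inv := by
    rintro (a | b)
    · rfl
    · fin_cases b <;> rfl
  right_inv := by
    rintro (((a | a) | a) | a) <;> rfl
  map_rel_iff' := by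
    rintro (a | a) (b | b)
    · simp
    · fin_cases b <;> simp
    · fin_cases a <;> simp
    · fin_cases a <;> fin_cases b <;> simp [path_three_adj_zero, path_three_adj_one,
        path_three_adj_two]

end Pendant

/-! ### Reductions for concrete pendant configurations -/

/-- The vertex `y` has degree two, and its neighbour `b` other than `q` is a leaf. -/
structure IsWeakAt {V : Type*} (T : SimpleGraph V) (y q b : V) : Prop where
  adj : T.Adj y q
  adj_leaf : T.Adj y b
  ne : b ≠ q
  isLeaf : IsLeaf T b
  eq_or : ∀ x, T.Adj y x → x = q ∨ x = b

/-- A path `l - y - a - b` of order four is attached to `q` by its vertex `y`. -/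
structure IsPathAt {V : Type*} (T : SimpleGraph V) (y q l a b : V) : Prop where
  adj : T.Adj y q
  adj_leaf : T.Adj y l
  ne : l ≠ q
  isLeaf : IsLeaf T l
  ne_left : a ≠ q
  ne_leaf : a ≠ l
  weak : IsWeakAt T a y b
  eq_or : ∀ x, T.Adj y x → x = q ∨ x = l ∨ x = a

section Concrete

variable {V : Type u} [Fintype V] {T : SimpleGraph V} {v u w h l y q a b c p z : V}

theorem IsWeakAt.leaf_eq (hw : IsWeakAt T y q b) {x : V} (hx : T.Adj b x) : x = y :=
  hw.isLeaf.eq_of_adj hx hw.adj_leaf.symm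

/-- Removing `l` undoes `F2`: the remaining leaf `h` and the neighbour `y` allow label two on `v` at
no extra cost. -/
theorem hasReduction_of_leaf (hT : T.IsTree) (he : domNumber False T = domNumber True T)
    (hh : T.Adj v h) (hhl : IsLeaf T h) (hl : T.Adj v l) (hll : IsLeaf T l) (hy : T.Adj v y)
    (hhl' : h ≠ l) (hyh : y ≠ h) (hyl : y ≠ l) (hys : IsLeaf T y ∨ IsSupport T y) :
    HasReduction T := by
  classical
  have hr : ∀ a, a ∈ (Set.range fun _ : Unit => l)ᶜ ↔ a ≠ l := fun a => by simp [eq_comm]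
  obtain ⟨e⟩ := exists_iso_of_pendant (T := T) (H := (⊥ : SimpleGraph Unit)) (v := v) (x := ())
    (fun _ => l) (fun _ _ _ => rfl) ((hr v).2 hl.ne) hl (by simp)
    (fun s x hx => .inl ⟨rfl, hll.eq_of_adj hx hl.symm⟩)
  refine hasReduction_addLeaf (h := ⟨h, (hr h).2 hhl'⟩) (y := ⟨y, (hr y).2 hyl⟩) e hT he
    (by simpa using hh) (isLeaf_induce hhl hh.symm ((hr h).2 hhl') ((hr v).2 hl.ne)) (by simpa using hy)
    (by simpa [Subtype.ext_iff] using hyh) ?_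
  refine hys.imp (fun h => isLeaf_induce h hy.symm _ ((hr v).2 hl.ne)) ?_
  rintro ⟨b, hyb, hb⟩
  have hbl : b ≠ l := by
    rintro rfl
    exact hy.ne (hll.eq_of_adj hl.symm hyb.symm)
  exact ⟨⟨b, (hr b).2 hbl⟩, hyb, isLeaf_induce hb hyb.symm _ ((hr y).2 hyl)⟩

theorem hasReduction_of_two_leaves (hT : T.IsTree) (he : domNumber False T = domNumber True T)
    (hu : T.Adj v u) (hh : T.Adj v h) (hhl : IsLeaf T h) (hl : T.Adj v l) (hll : IsLeaf T l)
    (hhl' : h ≠ l) (huh : u ≠ h) (hul : u ≠ l) (hv : ∀ x, T.Adj v x → x = u ∨ x = h ∨ x = l) :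
    HasReduction T := by
  classical
  have hr : u ∈ (Set.range ![h, v, l])ᶜ := by
    rintro ⟨i, hi⟩
    fin_cases i
    · exact huh hi.symm
    · exact hu.ne hi
    · exact hul hi.symm
  have hinj : Function.Injective ![h, v, l] := by
    have h1 := hh.ne
    have h2 := hl.ne
    intro i j hij
    fin_cases i <;> fin_cases j <;> simp_all
  obtain ⟨e⟩ := exists_iso_of_pendant (T := T) (H := pathGraph 3) (v := u) (x := 1) ![h, v, l]
    hinj hr hu.symm
    (fun s t hst => by
      fin_cases s <;> fin_cases t <;>
        simp_all [path_three_adj_zero, path_three_adj_one, path_three_adj_two, T.adj_comm])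
    (fun s x hx => by
      fin_cases s
      · exact .inr ⟨1, by simp [path_three_adj_zero], hhl.eq_of_adj hh.symm hx⟩
      · rcases hv x hx with rfl | rfl | rfl
        · exact .inl ⟨rfl, rfl⟩
        · exact .inr ⟨0, by simp [path_three_adj_one], rfl⟩
        · exact .inr ⟨2, by simp [path_three_adj_one], rfl⟩
      · exact .inr ⟨1, by simp [path_three_adj_two], hll.eq_of_adj hl.symm hx⟩)
  exact hasReduction_addTwoLeaves (e.trans (joinStarIso _ _)) hT he

/-- Removing `a` and `b` undoes `F6` at `u`, since the adjacent support vertex `w` keeps `u` totally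
dominated. -/
theorem hasReduction_of_isWeakAt (hT : T.IsTree) (he : domNumber False T = domNumber True T)
    (ha : IsWeakAt T a u b) (hw : T.Adj u w) (hwa : w ≠ a) (hh : T.Adj w h) (hl : IsLeaf T h)
    (hhu : h ≠ u) : HasReduction T := by
  classical
  have hr : ∀ x, x ∈ (Set.range ![a, b])ᶜ ↔ x ≠ a ∧ x ≠ b := fun x => by
    simp [eq_comm, and_comm]
  have hu : u ∈ (Set.range ![a, b])ᶜ := (hr u).2 ⟨ha.adj.ne', ha.ne.symm⟩
  have hwb : w ≠ b := by
    rintro rfl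
    exact ha.adj.ne' (ha.leaf_eq hw.symm)
  have hha : h ≠ a := by
    rintro rfl
    rcases ha.eq_or w hh.symm with rfl | rfl
    · exact hw.ne rfl
    · exact hwb rfl
  have hhb : h ≠ b := by
    rintro rfl
    exact hwa (ha.leaf_eq hh.symm)
  obtain ⟨e⟩ := exists_iso_of_pendant (T := T) (H := pathGraph 2) (v := u) (x := 0) ![a, b]
    (by
      have := ha.adj_leaf.ne
      intro i j hij
      fin_cases i <;> fin_cases j <;> simp_all)
    hu ha.adj.symm
    (fun s t hst => by
      have := ha.adj_leaf
      fin_cases s <;> fin_cases t <;>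
        simp_all [path_two_adj_zero, path_two_adj_one, T.adj_comm])
    (fun s x hx => by
      fin_cases s
      · rcases ha.eq_or x hx with rfl | rfl
        · exact .inl ⟨rfl, rfl⟩
        · exact .inr ⟨1, by simp [path_two_adj_zero], rfl⟩
      · exact .inr ⟨0, by simp [path_two_adj_one], (ha.leaf_eq hx).symm⟩)
  have hw' := (hr w).2 ⟨hwa, hwb⟩
  have hh' := (hr h).2 ⟨hha, hhb⟩
  have hw₁ : (T.induce (Set.range ![a, b])ᶜ).Adj ⟨u, hu⟩ ⟨w, hw'⟩ := hw
  have hh₁ : (T.induce (Set.range ![a, b])ᶜ).Adj ⟨w, hw'⟩ ⟨h, hh'⟩ := hh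
  exact hasReduction_addPathTwo e hT he hw₁ hh₁ (isLeaf_induce hl hh.symm hh' hw')
    (by simpa [Subtype.ext_iff] using hhu)

/-- The pendant path `y`, `a`, `b` is shortened by two vertices, undoing `F6` at the leaf `y`, or
removed entirely, undoing `F7` at `p`. -/
theorem hasReduction_of_path (hT : T.IsTree) (he : domNumber False T = domNumber True T)
    (hp : T.Adj y p) (hap : a ≠ p) (ha : IsWeakAt T a y b) (hy : ∀ x, T.Adj y x → x = p ∨ x = a) :
    HasReduction T := by
  classical
  have hpb : p ≠ b := by
    rintro rfl
    exact ha.adj.ne' (ha.leaf_eq hp.symm)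
  have hr : p ∈ (Set.range ![y, a, b])ᶜ := by
    rintro ⟨i, hi⟩
    fin_cases i
    · exact hp.ne hi
    · exact hap hi
    · exact hpb hi.symm
  obtain ⟨e⟩ := exists_iso_of_pendant (T := T) (H := pathGraph 3) (v := p) (x := 0) ![y, a, b]
    (by
      have h1 := ha.adj_leaf.ne
      have h2 := ha.adj.ne
      have h3 := ha.ne
      intro i j hij
      fin_cases i <;> fin_cases j <;> simp_all)
    hr hp.symm
    (fun s t hst => by
      have h1 := ha.adj_leaf
      have h2 := ha.adj
      fin_cases s <;> fin_cases t <;>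
        simp_all [path_three_adj_zero, path_three_adj_one, path_three_adj_two, T.adj_comm])
    (fun s x hx => by
      fin_cases s
      · rcases hy x hx with rfl | rfl
        · exact .inl ⟨rfl, rfl⟩
        · exact .inr ⟨1, by simp [path_three_adj_zero], rfl⟩
      · rcases ha.eq_or x hx with rfl | rfl
        · exact .inr ⟨0, by simp [path_three_adj_one], rfl⟩
        · exact .inr ⟨2, by simp [path_three_adj_one], rfl⟩
      · exact .inr ⟨1, by simp [path_three_adj_two], (ha.leaf_eq hx).symm⟩)
  exact hasReduction_addPathThree e hT he

theorem IsPathAt.ne_left_end (hy : IsPathAt T y q l a b) : q ≠ b := by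
  rintro rfl
  exact hy.weak.adj.ne' (hy.weak.leaf_eq hy.adj.symm)

/-- A neighbour `z` of `q` is no vertex of an attached path but possibly the vertex next to `q`. -/
theorem IsPathAt.ne_of_adj (hy : IsPathAt T y q l a b) (hz : T.Adj q z) :
    z ≠ l ∧ z ≠ a ∧ z ≠ b := by
  refine ⟨?_, ?_, ?_⟩
  · rintro rfl
    exact hy.adj.ne' (hy.isLeaf.eq_of_adj hz.symm hy.adj_leaf.symm)
  · rintro rfl
    rcases hy.weak.eq_or q hz.symm with h | h
    · exact hy.adj.ne' h
    · exact hy.ne_left_end h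
  · rintro rfl
    exact hy.ne_left (hy.weak.leaf_eq hz.symm).symm

theorem hasReduction_of_isPathAt (hT : T.IsTree) (he : domNumber False T = domNumber True T)
    (hz : T.Adj p z) (hzl : ¬ IsLeaf T z) (hex : ∃ y, T.Adj p y ∧ y ≠ z)
    (hp : ∀ y, T.Adj p y → y ≠ z → ∃ l a b, IsPathAt T y p l a b) : HasReduction T := by
  classical
  let C := {y // T.Adj p y ∧ y ≠ z}
  obtain ⟨r, ⟨c⟩⟩ := Finite.exists_equiv_fin C
  have hr : 1 ≤ r := by
    obtain ⟨y, hy⟩ := hex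
    exact (Nat.zero_le _).trans_lt (c ⟨y, hy⟩).2
  let Y : Fin r → V := fun i => (c.symm i).1
  have hY : ∀ i, T.Adj p (Y i) ∧ Y i ≠ z := fun i => (c.symm i).2
  have hYinj : ∀ i j, Y i = Y j → i = j := fun i j h => c.symm.injective (Subtype.ext h)
  have hYsurj : ∀ y, T.Adj p y → y ≠ z → ∃ i, Y i = y := fun y h1 h2 =>
    ⟨c ⟨y, h1, h2⟩, by simp [Y]⟩
  choose L A B hP using fun i => hp (Y i) (hY i).1 (hY i).2
  clear_value Y
  -- Vertices of different kinds or from different copies are distinct because the leaves and the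
  -- vertices `A i` have their neighbours prescribed.
  have hYne : ∀ i j, Y i ≠ L j ∧ Y i ≠ A j ∧ Y i ≠ B j := fun i j => (hP j).ne_of_adj (hY i).1
  have hL : ∀ i x, T.Adj (L i) x → x = Y i := fun i x hx =>
    (hP i).isLeaf.eq_of_adj hx (hP i).adj_leaf.symm
  have hB : ∀ i x, T.Adj (B i) x → x = A i := fun i x hx => (hP i).weak.leaf_eq hx
  have hLA : ∀ i j, L i ≠ A j := fun i j h => by
    have h1 := hL i (Y j) (h ▸ (hP j).weak.adj)
    have h2 := hL i (B j) (h ▸ (hP j).weak.adj_leaf)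
    exact (hYne j j).2.2 (h1.trans h2.symm)
  have hLB : ∀ i j, L i ≠ B j := fun i j h =>
    (hYne i j).2.1 (hB j (Y i) (h ▸ (hP i).adj_leaf.symm))
  have hAB : ∀ i j, A i ≠ B j := fun i j h => by
    have h1 := hB j (Y i) (h ▸ (hP i).weak.adj)
    exact (hYne i j).2.1 h1
  have hLL : ∀ i j, L i = L j → i = j := fun i j h =>
    hYinj i j (hL j (Y i) (h ▸ (hP i).adj_leaf.symm))
  have hAA : ∀ i j, A i = A j → i = j := fun i j h =>
    hYinj i j (((hP j).weak.eq_or (Y i) (h ▸ (hP i).weak.adj)).resolve_right (hYne i j).2.2)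
  have hBB : ∀ i j, B i = B j → i = j := fun i j h =>
    hAA i j (hB j (A i) (h ▸ (hP i).weak.adj_leaf.symm))
  have hpne : ∀ i, p ≠ Y i ∧ p ≠ L i ∧ p ≠ A i ∧ p ≠ B i := fun i =>
    ⟨(hY i).1.ne, (hP i).ne.symm, (hP i).ne_left.symm, (hP i).ne_left_end⟩
  let φ : Unit ⊕ Fin r × Fin 4 → V :=
    Sum.elim (fun _ => p) fun s => ![L s.1, Y s.1, A s.1, B s.1] s.2
  have hzr : z ∈ (Set.range φ)ᶜ := by
    rintro ⟨s | ⟨i, k⟩, hs⟩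
    · exact hz.ne hs
    · have h1 := (hP i).ne_of_adj hz
      fin_cases k
      · exact h1.1 hs.symm
      · exact (hY i).2 hs
      · exact h1.2.1 hs.symm
      · exact h1.2.2 hs.symm
  have hinj : Function.Injective φ := by
    rintro (s | ⟨i, k⟩) (t | ⟨j, m⟩) hst
    · rfl
    · have := hpne j
      fin_cases m
      · exact absurd hst this.2.1
      · exact absurd hst this.1
      · exact absurd hst this.2.2.1
      · exact absurd hst this.2.2.2
    · have := hpne i
      fin_cases k
      · exact absurd hst.symm this.2.1
      · exact absurd hst.symm this.1
      · exact absurd hst.symm this.2.2.1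
      · exact absurd hst.symm this.2.2.2
    · have h1 := hYne i j
      have h2 := hYne j i
      fin_cases k <;> fin_cases m
      · rw [hLL i j hst]
      · exact absurd hst.symm h2.1
      · exact absurd hst (hLA i j)
      · exact absurd hst (hLB i j)
      · exact absurd hst h1.1
      · rw [hYinj i j hst]
      · exact absurd hst h1.2.1
      · exact absurd hst h1.2.2
      · exact absurd hst.symm (hLA j i)
      · exact absurd hst.symm h2.2.1
      · rw [hAA i j hst]
      · exact absurd hst (hAB i j)
      · exact absurd hst.symm (hLB j i)
      · exact absurd hst.symm h2.2.2
      · exact absurd hst.symm (hAB j i)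
      · rw [hBB i j hst]
  obtain ⟨e⟩ := exists_iso_of_pendant (T := T) (H := treeR r) (v := z) (x := .inl ()) φ hinj hzr
    hz.symm
    (by
      rintro (s | ⟨i, k⟩) (t | ⟨j, m⟩) hst
      · simp [treeR] at hst
      · obtain rfl : m = 1 := by simpa using hst
        exact (hY j).1
      · obtain rfl : k = 1 := by simpa using hst
        exact (hY i).1.symm
      · simp only [treeR_adj_inr_inr] at hst
        obtain ⟨rfl, hst⟩ := hst
        have h1 := hP i
        have h2 := h1.weak
        fin_cases k <;> simp [path_four_adj_zero, path_four_adj_one, path_four_adj_two,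
          path_four_adj_three] at hst
        · subst hst; exact h1.adj_leaf.symm
        · rcases hst with rfl | rfl
          · exact h1.adj_leaf
          · exact h2.adj.symm
        · rcases hst with rfl | rfl
          · exact h2.adj
          · exact h2.adj_leaf
        · subst hst; exact h2.adj_leaf.symm)
    (by
      rintro (s | ⟨i, k⟩) x hx
      · by_cases hxz : x = z
        · exact .inl ⟨rfl, hxz⟩
        · obtain ⟨i, hi⟩ := hYsurj x hx hxz
          exact .inr ⟨.inr (i, 1), by simp, hi⟩
      · fin_cases k
        · exact .inr ⟨.inr (i, 1), by simp [path_four_adj_zero], (hL i x hx).symm⟩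
        · rcases (hP i).eq_or x hx with h | h | h
          · exact .inr ⟨.inl (), by simp, h.symm⟩
          · exact .inr ⟨.inr (i, 0), by simp [path_four_adj_one], h.symm⟩
          · exact .inr ⟨.inr (i, 2), by simp [path_four_adj_one], h.symm⟩
        · rcases (hP i).weak.eq_or x hx with h | h
          · exact .inr ⟨.inr (i, 1), by simp [path_four_adj_two], h.symm⟩
          · exact .inr ⟨.inr (i, 3), by simp [path_four_adj_two], h.symm⟩
        · exact .inr ⟨.inr (i, 2), by simp [path_four_adj_three], (hB i x hx).symm⟩)
  -- As `z` is not a leaf, the tree that remains has at least two vertices.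
  obtain ⟨w, hzw, hwp⟩ : ∃ w, T.Adj z w ∧ w ≠ p := by
    by_contra! h
    exact hzl (isLeaf_of_forall hz.symm h)
  have hwr : w ∈ (Set.range φ)ᶜ := by
    rintro ⟨s | ⟨i, k⟩, hs⟩
    · exact hwp hs.symm
    · have h1 := (hP i).ne_of_adj hz
      have h2 := (hY i).2
      fin_cases k
      · have h3 : L i = w := hs
        subst h3
        exact h2 (hL i z hzw.symm).symm
      · have h3 : Y i = w := hs
        subst h3
        rcases (hP i).eq_or z hzw.symm with h | h | h
        · exact hz.ne' h
        · exact h1.1 h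
        · exact h1.2.1 h
      · have h3 : A i = w := hs
        subst h3
        rcases (hP i).weak.eq_or z hzw.symm with h | h
        · exact h2 h.symm
        · exact h1.2.2 h
      · have h3 : B i = w := hs
        subst h3
        exact h1.2.1 (hB i z hzw.symm)
  have hzw' : (T.induce (Set.range φ)ᶜ).Adj ⟨z, hzr⟩ ⟨w, hwr⟩ := hzw
  exact hasReduction_addTreeR e hr hT he hzw'

end Concrete

/-! ### Levels of a rooted tree -/

section Levels

variable {V : Type*} {T : SimpleGraph V} {r x y y' : V}

theorem exists_adj_dist (hT : T.IsTree) (hx : x ≠ r) :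
    ∃ y, T.Adj x y ∧ T.dist r x = T.dist r y + 1 := by
  obtain ⟨p, hp⟩ := hT.1.exists_walk_length_eq_dist x r
  cases p with
  | nil => exact absurd rfl hx
  | @cons _ y _ h q =>
    refine ⟨y, h, (hT.dist_eq_dist_add_one_of_adj r h).resolve_right fun h' => ?_⟩
    have h1 := dist_le q
    rw [Walk.length_cons] at hp
    rw [dist_comm (u := r), dist_comm (u := r)] at h'
    omega

/-- A neighbour of `x` closer to the root is the penultimate vertex of a shortest path to `x`, since
a shortest path to that neighbour is too short to pass through `x`. -/
theorem eq_of_adj_of_dist (hT : T.IsTree) (hy : T.Adj x y) (hy' : T.Adj x y')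
    (hd : T.dist r x = T.dist r y + 1) (hd' : T.dist r x = T.dist r y' + 1) : y = y' := by
  classical
  obtain ⟨p, hp, -⟩ := hT.1.exists_path_of_dist r x
  have key : ∀ z, T.Adj x z → T.dist r x = T.dist r z + 1 → z = p.penultimate := by
    intro z hz hdz
    obtain ⟨q, hq, hql⟩ := hT.1.exists_path_of_dist r z
    refine hT.2.eq_penultimate_of_adj_end hp hz
      (hT.2.mem_support_of_ne_mem_support_of_adj_of_isPath hp hq hz fun hx => ?_)
    have h1 := dist_le (q.takeUntil x hx)
    have h2 := q.length_takeUntil_le_length hx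
    omega
  rw [key y hy hd, key y' hy' hd']

theorem dist_eq_of_adj_ne (hT : T.IsTree) (hy : T.Adj x y) (hd : T.dist r x = T.dist r y + 1)
    (hy' : T.Adj x y') (hne : y' ≠ y) : T.dist r y' = T.dist r x + 1 :=
  (hT.dist_eq_dist_add_one_of_adj r hy').resolve_left fun h =>
    hne (eq_of_adj_of_dist hT hy' hy h hd)

end Levels

/-! ### The bottom levels of an irreducible tree -/

section Structure

variable {V : Type u} [Fintype V] {T : SimpleGraph V} {r q x y p : V} {D : ℕ}

/-- A vertex whose neighbours but `q` are leaves. -/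
theorem exists_isWeakAt (hT : T.IsTree) (he : domNumber False T = domNumber True T)
    (hred : ¬ HasReduction T) (hxq : T.Adj x q) (hl : ∀ y, T.Adj x y → y ≠ q → IsLeaf T y)
    (hx : ¬ IsLeaf T x) : ∃ b, IsWeakAt T x q b := by
  obtain ⟨b, hb, hbq⟩ : ∃ b, T.Adj x b ∧ b ≠ q := by
    by_contra! h
    exact hx (isLeaf_of_forall hxq h)
  refine ⟨b, hxq, hb, hbq, hl b hb hbq, ?_⟩
  by_contra! hc
  obtain ⟨c, hc, hcq, hcb⟩ := hc
  -- A third leaf allows `F2` to be undone; exactly two leaves form a pendant star.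
  by_cases hd : ∃ d, T.Adj x d ∧ d ≠ q ∧ d ≠ b ∧ d ≠ c
  · obtain ⟨d, hd, hdq, hdb, hdc⟩ := hd
    exact hred (hasReduction_of_leaf hT he hb (hl b hb hbq) hc (hl c hc hcq) hd hcb.symm hdb hdc
      (.inl (hl d hd hdq)))
  · push Not at hd
    exact hred (hasReduction_of_two_leaves hT he hxq hb (hl b hb hbq) hc (hl c hc hcq) hcb.symm
      hbq.symm hcq.symm fun d hd' => by
        by_contra! h
        exact h.2.2 (hd d hd' h.1 h.2.1))

/-- A vertex whose neighbours but `q` are leaves or weak. -/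
theorem exists_isPathAt (hT : T.IsTree) (he : domNumber False T = domNumber True T)
    (hred : ¬ HasReduction T) (hxq : T.Adj x q) {a b : V} (ha : IsWeakAt T a x b) (haq : a ≠ q)
    (hl : ∀ y, T.Adj x y → y ≠ q → IsLeaf T y ∨ ∃ b, IsWeakAt T y x b) :
    ∃ l, IsPathAt T x q l a b := by
  -- A second weak neighbour of `x` is a support vertex, which would make the path `a`, `b`
  -- removable.
  have hl' : ∀ y, T.Adj x y → y ≠ q → y ≠ a → IsLeaf T y := fun y hy hyq hya =>
    (hl y hy hyq).resolve_right fun ⟨b', hb'⟩ =>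
      hred (hasReduction_of_isWeakAt hT he ha hy hya hb'.adj_leaf hb'.isLeaf hb'.ne)
  -- Otherwise `x`, `a`, `b` would be a pendant path of order three.
  obtain ⟨l, hxl, hlq, hla⟩ : ∃ l, T.Adj x l ∧ l ≠ q ∧ l ≠ a := by
    by_contra! h
    exact hred (hasReduction_of_path hT he hxq haq ha fun y hy => by
      by_contra! h'
      exact h'.2 (h y hy h'.1))
  refine ⟨l, hxq, hxl, hlq, hl' l hxl hlq hla, haq, hla.symm, ha, ?_⟩
  -- Two leaves at `x` next to the support vertex `a` would make one of them removable.
  by_contra! hc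
  obtain ⟨c, hc, hcq, hcl, hca⟩ := hc
  exact hred (hasReduction_of_leaf hT he hxl (hl' l hxl hlq hla) hc (hl' c hc hcq hca) ha.adj.symm
    hcl.symm hla.symm hca.symm (.inr ⟨b, ha.adj_leaf, ha.isLeaf⟩))

theorem isLeaf_of_dist (hT : T.IsTree) (hD : ∀ y, T.dist r y ≤ D) (hxq : T.Adj x q)
    (hq : T.dist r x = T.dist r q + 1) (hx : T.dist r x = D) : IsLeaf T x := by
  refine isLeaf_of_forall hxq fun y hy => ?_
  by_contra hne
  have h1 := dist_eq_of_adj_ne hT hxq hq hy hne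
  have h2 := hD y
  omega

theorem isLeaf_or_isWeakAt (hT : T.IsTree) (he : domNumber False T = domNumber True T)
    (hred : ¬ HasReduction T) (hD : ∀ y, T.dist r y ≤ D) (hxq : T.Adj x q)
    (hq : T.dist r x = T.dist r q + 1) (hx : T.dist r x + 1 = D) :
    IsLeaf T x ∨ ∃ b, IsWeakAt T x q b := by
  refine or_iff_not_imp_left.2 fun h => exists_isWeakAt hT he hred hxq (fun y hy hyq => ?_) h
  have h1 := dist_eq_of_adj_ne hT hxq hq hy hyq
  exact isLeaf_of_dist hT hD hy.symm h1 (h1.trans hx)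

theorem isLeaf_or_isWeakAt_or_isPathAt (hT : T.IsTree)
    (he : domNumber False T = domNumber True T) (hred : ¬ HasReduction T)
    (hD : ∀ y, T.dist r y ≤ D) (hxq : T.Adj x q) (hq : T.dist r x = T.dist r q + 1)
    (hx : T.dist r x + 2 = D) :
    IsLeaf T x ∨ (∃ b, IsWeakAt T x q b) ∨ ∃ l a b, IsPathAt T x q l a b := by
  have hc : ∀ y, T.Adj x y → y ≠ q → IsLeaf T y ∨ ∃ b, IsWeakAt T y x b := fun y hy hyq => by
    have h1 := dist_eq_of_adj_ne hT hxq hq hy hyq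
    exact isLeaf_or_isWeakAt hT he hred hD hy.symm h1 (by omega)
  by_cases hw : ∃ a, T.Adj x a ∧ a ≠ q ∧ ∃ b, IsWeakAt T a x b
  · obtain ⟨a, -, haq, b, hb⟩ := hw
    obtain ⟨l, hl⟩ := exists_isPathAt hT he hred hxq hb haq hc
    exact .inr (.inr ⟨l, a, b, hl⟩)
  · refine or_iff_not_imp_left.2 fun h => .inl (exists_isWeakAt hT he hred hxq
      (fun y hy hyq => (hc y hy hyq).resolve_right fun h' => hw ⟨y, hy, hyq, h'⟩) h)

theorem IsPathAt.not_isLeaf {l a b : V} (hx : IsPathAt T x q l a b) : ¬ IsLeaf T x := fun h =>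
  hx.ne (h.eq_of_adj hx.adj_leaf hx.adj)

/-- A tree with a vertex at distance three from the leaf `r`. -/
theorem hasReduction_of_three_le_dist (hT : T.IsTree) (he : domNumber False T = domNumber True T)
    (hr : IsLeaf T r) (hD : ∀ y, T.dist r y ≤ D) {v₁ : V} (hv₁ : T.dist r v₁ = D) (h3 : 3 ≤ D) :
    HasReduction T := by
  by_contra hred
  have hne : ∀ v, 0 < T.dist r v → v ≠ r := by
    rintro v hv rfl
    simp at hv
  obtain ⟨v₂, a₁, d₁⟩ := exists_adj_dist hT (hne v₁ (by omega))
  obtain ⟨x, a₂, d₂⟩ := exists_adj_dist hT (hne v₂ (by omega))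
  obtain ⟨p, a₃, d₃⟩ := exists_adj_dist hT (hne x (by omega))
  have hv₁x : v₁ ≠ x := by rintro rfl; omega
  have hv₂p : v₂ ≠ p := by rintro rfl; omega
  -- The descending path from `x` through `v₂` to `v₁` excludes the other two shapes.
  obtain ⟨l, a, b, hx⟩ : ∃ l a b, IsPathAt T x p l a b := by
    rcases isLeaf_or_isWeakAt_or_isPathAt hT he hred hD a₃ d₃ (by omega) with h | ⟨b, h⟩ | h
    · exact absurd (h.eq_of_adj a₂.symm a₃) hv₂p
    · rcases h.eq_or v₂ a₂.symm with rfl | rfl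
      · exact absurd rfl hv₂p
      · exact absurd (h.isLeaf.eq_of_adj a₁.symm a₂) hv₁x
    · exact h
  -- A leaf `p` would be a second leaf at `x` besides `l`, next to the support vertex `a`. Hence `p`
  -- differs from the leaf `r` and has a parent `z`.
  have hpl : ¬ IsLeaf T p := fun h =>
    hred (hasReduction_of_leaf hT he hx.adj h hx.adj_leaf hx.isLeaf hx.weak.adj.symm hx.ne.symm
      hx.ne_left hx.ne_leaf (.inr ⟨b, hx.weak.adj_leaf, hx.weak.isLeaf⟩))
  obtain ⟨z, a₄, d₄⟩ := exists_adj_dist hT fun h : p = r => hpl (h ▸ hr)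
  have hxz : x ≠ z := by rintro rfl; omega
  -- A leaf at `p` would make `p` a support vertex next to `x`, and `a`, `b` removable.
  have hleaf : ∀ y, T.Adj p y → ¬ IsLeaf T y := fun y hy hyl =>
    hred (hasReduction_of_isWeakAt hT he hx.weak hx.adj hx.ne_left.symm hy hyl
      fun h => hx.not_isLeaf (h ▸ hyl))
  refine hred (hasReduction_of_isPathAt hT he a₄ (hleaf z a₄) ⟨x, a₃.symm, hxz⟩ fun y hy hyz => ?_)
  have dy := dist_eq_of_adj_ne hT a₄ d₄ hy hyz
  rcases isLeaf_or_isWeakAt_or_isPathAt hT he hred hD hy.symm dy (by omega) with h | ⟨c, h⟩ | h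
  · exact absurd h (hleaf y hy)
  · have hxy : x ≠ y := by
      rintro rfl
      rcases h.eq_or v₂ a₂.symm with rfl | rfl
      · exact hv₂p rfl
      · exact hv₁x (h.isLeaf.eq_of_adj a₁.symm a₂)
    -- A weak child of `p` is removable together with its leaf because `x` is a support vertex next
    -- to `p`.
    exact absurd (hasReduction_of_isWeakAt hT he h a₃.symm hxy hx.adj_leaf hx.isLeaf hx.ne) hred
  · exact h

/-- A tree of order at least four with no vertex at distance three from the leaf `r`. -/
theorem hasReduction_of_dist_le_two (hT : T.IsTree) (he : domNumber False T = domNumber True T)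
    (hr : IsLeaf T r) (hD : ∀ y, T.dist r y ≤ 2) (hn : 4 ≤ Fintype.card V) : HasReduction T := by
  classical
  obtain ⟨x, hrx⟩ := noIsolated_of_connected hT.1 (by omega) r
  have hdx : T.dist r x = 1 := dist_eq_one_iff_adj.2 hrx
  have hall : ∀ y, y ≠ r → y ≠ x → T.Adj x y ∧ IsLeaf T y := by
    intro y hyr hyx
    obtain ⟨q, hyq, hq⟩ := exists_adj_dist hT hyr
    have h1 : T.dist r y ≠ 1 := fun h => hyx (hr.eq_of_adj (dist_eq_one_iff_adj.1 h) hrx)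
    have h2 := hD y
    have h3 : T.dist r q = 1 := by omega
    obtain rfl : q = x := hr.eq_of_adj (dist_eq_one_iff_adj.1 h3) hrx
    exact ⟨hyq.symm, isLeaf_of_dist hT hD hyq hq (by omega)⟩
  obtain ⟨y, hy⟩ := Finset.exists_mem_notMem_of_card_lt_card
    (s := {r, x}) (t := Finset.univ) (Finset.card_le_two.trans_lt (by rw [Finset.card_univ]; omega))
  obtain ⟨w, hw⟩ := Finset.exists_mem_notMem_of_card_lt_card (s := {r, x, y}) (t := Finset.univ)
    (Finset.card_le_three.trans_lt (by rw [Finset.card_univ]; omega))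
  simp only [Finset.mem_univ, Finset.mem_insert, Finset.mem_singleton, not_or, true_and] at hy hw
  obtain ⟨h1, h2⟩ := hall y hy.1 hy.2
  obtain ⟨h3, h4⟩ := hall w hw.1 hw.2.1
  exact hasReduction_of_leaf hT he hrx.symm hr h1 h2 h3 (Ne.symm hy.1) hw.1 hw.2.2 (.inl h4)

end Structure

/-! ### Small trees and the induction -/

section Small

variable {V : Type u} [Fintype V] {T : SimpleGraph V}

theorem exists_isLeaf (hT : T.IsTree) (hn : 2 ≤ Fintype.card V) : ∃ r, IsLeaf T r := by
  classical
  have : Nontrivial V := Fintype.one_lt_card_iff_nontrivial.1 hn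
  obtain ⟨r, hr⟩ := hT.exists_vert_degree_one_of_nontrivial
  refine ⟨r, ?_⟩
  rw [IsLeaf, Set.ncard_eq_toFinset_card']
  exact hr

theorem nonempty_iso_path_two (hT : T.Connected) (hn : Fintype.card V = 2) :
    Nonempty (T ≃g pathGraph 2) := by
  let c := Fintype.equivFinOfCardEq hn
  have key : ∀ a b, T.Adj a b ↔ a ≠ b := by
    refine fun a b => ⟨fun h => h.ne, fun h => ?_⟩
    obtain ⟨d, hd⟩ := noIsolated_of_connected hT hn.ge a
    have : d = b := by
      by_contra hdb
      have := Fintype.two_lt_card_iff.2 ⟨a, b, d, h, hd.ne, Ne.symm hdb⟩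
      omega
    exact this ▸ hd
  refine ⟨⟨c, ?_⟩⟩
  intro a b
  rw [key, ← c.injective.ne_iff]
  generalize c a = i
  generalize c b = j
  fin_cases i <;> fin_cases j <;> simp [pathGraph_adj]

/-- Here `F3` is undone: on `P_2` both vertices are support vertices, hence positive, and the
minimum weight is two, so every minimum TR2DF is constantly one. -/
theorem hasReduction_of_card_eq_three (hT : T.IsTree) (hn : Fintype.card V = 3) :
    HasReduction T := by
  classical
  obtain ⟨l, hl⟩ := exists_isLeaf hT (by omega)
  obtain ⟨v, hv⟩ := noIsolated_of_connected hT.1 (by omega) l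
  have hr : v ∈ (Set.range fun _ : Unit => l)ᶜ := by simpa using hv.ne.symm
  obtain ⟨e⟩ := exists_iso_of_pendant (T := T) (H := (⊥ : SimpleGraph Unit)) (v := v) (x := ())
    (fun _ => l) (fun _ _ _ => rfl) hr hv.symm (by simp)
    (fun s x hx => .inl ⟨rfl, hl.eq_of_adj hx hv⟩)
  set G := T.induce (Set.range fun _ : Unit => l)ᶜ
  have hG := isTree_left_of_iso e hT
  have hc := Fintype.card_congr e.toEquiv
  rw [Fintype.card_sum, Fintype.card_unit, hn] at hc
  have hn' := noIsolated_of_connected hG.1 (by omega)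
  obtain ⟨i⟩ := nonempty_iso_path_two hG.1 (by omega)
  have h2 : ∀ R, domNumber R G = 2 := fun R => by rw [domNumber_congr _ i, domNumber_path_two]
  obtain ⟨h, hvh⟩ := hn' ⟨v, hr⟩
  have key : ∀ x y, G.Adj x y → IsLeaf G x := fun x y hxy => isLeaf_of_forall hxy fun d hd => by
    by_contra hdy
    have := Fintype.two_lt_card_iff.2 ⟨x, y, d, hxy.ne, hd.ne, Ne.symm hdy⟩
    omega
  refine ⟨_, inferInstance, G, hG, by omega, by omega, (h2 _).trans (h2 _).symm,
    .F3 ⟨v, hr⟩ (mem_supportOne_iff.2 ⟨⟨h, hvh, key _ _ hvh.symm⟩, fun f hf hw => ?_⟩) e⟩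
  have p1 := hf.pos_of_isSupport ⟨h, hvh, key _ _ hvh.symm⟩
  have p2 := hf.pos_of_isSupport ⟨_, hvh.symm, key _ _ hvh⟩
  rw [h2] at hw
  have h3 : (f ⟨v, hr⟩ : ℕ) + f h ≤ weight f :=
    Finset.add_le_sum (f := fun x => (f x : ℕ)) (fun _ _ => Nat.zero_le _) (Finset.mem_univ _)
      (Finset.mem_univ _) hvh.ne
  omega

theorem hasReduction (hT : T.IsTree) (hn : 3 ≤ Fintype.card V)
    (he : domNumber False T = domNumber True T) : HasReduction T := by
  rcases hn.eq_or_lt with h | h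
  · exact hasReduction_of_card_eq_three hT h.symm
  obtain ⟨r, hr⟩ := exists_isLeaf hT (by omega)
  have : Nonempty V := ⟨r⟩
  obtain ⟨v, hv⟩ := Finite.exists_max (T.dist r)
  by_cases h3 : 3 ≤ T.dist r v
  · exact hasReduction_of_three_le_dist hT he hr hv rfl h3
  · exact hasReduction_of_dist_le_two hT he hr (fun y => (hv y).trans (by omega)) h

end Small

theorem familyF_of_domNumber_eq {V : Type u} [Fintype V] {T : SimpleGraph V} (hT : T.IsTree)
    (hn : 2 ≤ Fintype.card V) (he : domNumber False T = domNumber True T) : FamilyF T := by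
  induction hc : Fintype.card V using Nat.strong_induction_on generalizing V with
  | _ n ih =>
    subst hc
    rcases hn.eq_or_lt with h | h
    · obtain ⟨e⟩ := nonempty_iso_path_two hT.1 h.symm
      exact .base T e
    · obtain ⟨V', _, T', hT', h2, hlt, he', hop⟩ := hasReduction hT h he
      exact .step T' T (ih _ hlt hT' h2 he' rfl) hop

end TotalRoman

theorem mainTheorem1 {V : Type u} [Fintype V] (T : SimpleGraph V) (hT : T.IsTree)
    (hn : 2 ≤ Fintype.card V) :
    TotalRoman.gammaTR2 T = TotalRoman.gammaTR T ↔ TotalRoman.FamilyF T := by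
  rw [TotalRoman.gammaTR2_eq, TotalRoman.gammaTR_eq]
  exact ⟨TotalRoman.familyF_of_domNumber_eq hT hn, fun h => h.domNumber_eq.2⟩
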